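/- There exist an infinite-dimensional commutative complex Banach algebra $A$ (not assumed unital) and an element $a\in A$ that is chaotic, meaning that both $\{za^n : z\in\mathbb C,\ n\ge 1\}$ and $\{(\mathbf 1+a)^n a : n\ge 1\}$ are dense in $A$ (where $\mathbf 1$ is the unit of the unitization of $A$), such that, with $M_a\colon A\to A$, $M_a b=ab$, and $I$ the identity operator on $A$, the following hold. 1. The operator $M_a$ is quasinilpotent (its spectral radius is $0$), the operator $I+M_a$ is hypercyclic (some orbit $\{(I+M_a)^n x : n\ge 0\}$ is dense in $A$), and $(I+M_a)\oplus(I+M_a)$, acting on $A\oplus A$, is not hypercyclic. 2. The series $\sum_{n=1}^\infty \frac{(-1)^{n-1}}{n}M_a^n$ converges in operator norm to a bounded linear operator $S=\ln(I+M_a)$ on $A$; $S$ is quasinilpotent, and $e^{nS}=(I+M_a)^n$ for every integer $n\ge 0$. 3. The family $\{e^{tS}\}_{t\ge 0}$ is an operator-norm continuous (in particular strongly continuous) one-parameter semigroup on $A$, and it is hypercyclic: there is $x\in A$ such that $\{e^{tS}x : t\ge 0\}$ is dense in $A$. 4. The strongly continuous semigroup $\{e^{tS}\oplus e^{tS}\}_{t\ge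 0}$, acting on $A\oplus A$, is not hypercyclic: for no $(x,y)\in A\oplus A$ is $\{(e^{tS}x,e^{tS}y) : t\ge 0\}$ dense in $A\oplus A$. In particular, there is a hypercyclic strongly continuous semigroup $\{T_t\}_{t\ge 0}$ on a Banach space $X$ for which the semigroup $\{T_t\oplus T_t\}_{t\ge 0}$ on $X\oplus X$ is not hypercyclic, which answers negatively a question of Bayart and Matheron whether $\{T_t\oplus T_t\}_{t\ge 0}$ must be hypercyclic whenever $\{T_t\}_{t\ge 0}$ is. -/

import Mathlib

open scoped NNReal

noncomputable section

section Operators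

variable {X : Type*} [NormedAddCommGroup X] [NormedSpace ℂ X]

/-- `T` is hypercyclic: some orbit `{T ^ n x : n ≥ 0}` is dense. -/
def IsHypercyclicOperator (T : X →L[ℂ] X) : Prop :=
  ∃ x : X, Dense (Set.range fun n : ℕ => (T ^ n) x)

/-- `T` is quasinilpotent: its spectral radius is zero. -/
def IsQuasinilpotentOperator (T : X →L[ℂ] X) : Prop :=
  spectralRadius ℂ T = 0

/-- `{T_t}` (`t ≥ 0`) is a strongly continuous one-parameter semigroup of bounded operators. -/
structure IsStronglyContinuousSemigroup (T : ℝ≥0 → X →L[ℂ] X) : Prop where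
  map_zero : T 0 = ContinuousLinearMap.id ℂ X
  map_add : ∀ s t : ℝ≥0, T (s + t) = (T s).comp (T t)
  continuous_orbit : ∀ x : X, Continuous fun t : ℝ≥0 => T t x

/-- `{T_t}` (`t ≥ 0`) is hypercyclic: some orbit `{T_t x : t ≥ 0}` is dense. -/
def IsHypercyclicSemigroup (T : ℝ≥0 → X →L[ℂ] X) : Prop :=
  ∃ x : X, Dense (Set.range fun t : ℝ≥0 => T t x)

/-- The family `t ↦ e ^ (t S)`, `t ≥ 0`. -/
def expSemigroup (S : X →L[ℂ] X) : ℝ≥0 → X →L[ℂ] X :=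
  fun t => NormedSpace.exp (((t : ℝ) : ℂ) • S)

/-- `T ⊕ T`, acting on `X × X`. -/
def directSumSelf (T : X →L[ℂ] X) : (X × X) →L[ℂ] (X × X) :=
  T.prodMap T

end Operators

section Algebras

variable {A : Type*} [NonUnitalNormedCommRing A] [NormedSpace ℂ A]
  [IsScalarTower ℂ A A] [SMulCommClass ℂ A A]

/-- `{z a ^ n : z ∈ ℂ, n ≥ 1}` is dense in `A` (powers are computed in the unitization). -/
def IsSupercyclicElement (a : A) : Prop :=
  Dense {b : A | ∃ (z : ℂ) (n : ℕ), 1 ≤ n ∧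
    (b : Unitization ℂ A) = z • (a : Unitization ℂ A) ^ n}

/-- `{(1 + a) ^ n a : n ≥ 1}` is dense in `A`, where `1` is the unit of the unitization. -/
def IsAlmostHypercyclicElement (a : A) : Prop :=
  Dense {b : A | ∃ n : ℕ, 1 ≤ n ∧
    (b : Unitization ℂ A) = (1 + (a : Unitization ℂ A)) ^ n * (a : Unitization ℂ A)}

/-- A chaotic element is both supercyclic and almost hypercyclic. -/
def IsChaoticElement (a : A) : Prop :=
  IsSupercyclicElement a ∧ IsAlmostHypercyclicElement a

/-- The multiplication operator `M_a b = a b`. -/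
def mulOperator (a : A) : A →L[ℂ] A :=
  ContinuousLinearMap.mul ℂ A a

end Algebras

end

noncomputable section

open Polynomial Filter Topology

/-! The algebra is the closed ideal generated by `a`, the image of `X`, in a completion of `ℂ[X]`.
The seminorm is the gauge of the absolutely convex hull of a submonoid `S` containing `X`. It is
submultiplicative because `S` is closed under products, and each element of `S` has seminorm at most
1. Putting `ε⁻¹ (c X ^ n - p)` and `ε⁻¹ ((1 + X) ^ m X - p)` into `S` for countably many `p` and `ε
→ 0` therefore forces both density conditions.

The danger is that `X` gets seminorm 0. `Separated` excludes this analytically: `z` must not equal,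
near 0, a series over `S` with coefficients of `ℓ¹`-norm at most 1/2.
`Separated.frequently_sup_powers` shows that some generators from a suitable sequence `u m` can be
added. If all late ones failed, a limit of the bad expansions would, on a set with an accumulation
point, be an expansion over `S` alone, and the identity theorem would contradict separation of `S`.
Suitable points, where `u m` is small but the path from 0 stays in `|u m| < 1`, come from choosing
`m`-th roots (`exists_tendsto_pow_eq`).

The rest is soft. Characters show that `a` is quasinilpotent, so `ln (1 + a)` exists
(`exists_log_one_add`), and the orbit of `a` under powers of `1 + a` is already dense. Every
operator in sight is a multiplication, and commutativity confines an orbit of pairs to a proper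
closed subspace (`IsChaoticGenerator.not_dense_range_prod`). -/

/-! ### Series of polynomials with absolutely summable coefficients. -/

theorem summable_mul_and_norm_tsum_sub_sum_le {α : Type*} {F c : α → ℂ} {C δ : ℝ}
    (hF : ∀ T : Finset α, ∑ a ∈ T, ‖F a‖ ≤ C) (E : Finset α)
    (h : ∀ a, a ∉ E → F a ≠ 0 → ‖c a‖ ≤ δ) (hδ : 0 ≤ δ) :
    (Summable fun a => F a * c a) ∧ ‖∑' a, F a * c a - ∑ a ∈ E, F a * c a‖ ≤ C * δ := by
  classical
  have hs : Summable fun a => ‖F a‖ := summable_of_sum_le (fun _ => norm_nonneg _) hF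
  have hC : ∑' a, ‖F a‖ ≤ C := hs.tsum_le_of_sum_le hF
  set d : α → ℂ := fun a => if a ∈ E then 0 else F a * c a with hd
  set e : α → ℂ := fun a => if a ∈ E then F a * c a else 0 with he
  have hde : (fun a => F a * c a) = fun a => e a + d a := by
    funext a; by_cases ha : a ∈ E <;> simp [hd, he, ha]
  have hdb : ∀ a, ‖d a‖ ≤ ‖F a‖ * δ := by
    intro a
    by_cases ha : a ∈ E
    · simp only [hd, ha, if_true, norm_zero]; positivity
    · by_cases hFa : F a = 0
      · simp [hd, ha, hFa]
      · simp only [hd, ha, if_false, norm_mul]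
        exact mul_le_mul_of_nonneg_left (h a ha hFa) (norm_nonneg _)
  have hds : Summable d := .of_norm_bounded (hs.mul_right δ) hdb
  have hE : HasSum e (∑ a ∈ E, F a * c a) := by
    have : ∑ a ∈ E, F a * c a = ∑ a ∈ E, e a :=
      Finset.sum_congr rfl fun a ha => by simp [he, ha]
    rw [this]
    exact hasSum_sum_of_ne_finset_zero fun a ha => by simp [he, ha]
  refine ⟨hde ▸ hE.summable.add hds, ?_⟩
  have ht : ∑' a, F a * c a = ∑ a ∈ E, F a * c a + ∑' a, d a := by
    rw [hde, (hE.add hds.hasSum).tsum_eq]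
    simp only [← hde]
  rw [ht, add_sub_cancel_left]
  refine (tsum_of_norm_bounded (hs.mul_right δ).hasSum hdb).trans ?_
  rw [tsum_mul_right]
  exact mul_le_mul_of_nonneg_right hC hδ

theorem analyticOnNhd_tsum_mul_eval {F : ℂ[X] → ℂ} {C : ℝ}
    (hF : ∀ T : Finset ℂ[X], ∑ g ∈ T, ‖F g‖ ≤ C) {Ω : Set ℂ} (hΩ : IsOpen Ω)
    (h : ∀ g, F g ≠ 0 → ∀ z ∈ Ω, ‖g.eval z‖ ≤ 1) :
    AnalyticOnNhd ℂ (fun z => ∑' g, F g * g.eval z) Ω := by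
  have hs : Summable fun g => ‖F g‖ := summable_of_sum_le (fun _ => norm_nonneg _) hF
  refine DifferentiableOn.analyticOnNhd ?_ hΩ
  refine Complex.differentiableOn_tsum_of_summable_norm hs
    (fun g => ((differentiable_const _).mul g.differentiable).differentiableOn) hΩ ?_
  intro g z hz
  by_cases hg : F g = 0
  · simp [hg]
  · rw [norm_mul]
    exact mul_le_of_le_one_right (norm_nonneg _) (h g hg z hz)

/-! ### Separated submonoids and the adjunction of one generator. -/

/-- The identity function has no expansion near `0` along `S` with coefficients of `ℓ¹`-norm at
most `1 / 2`. -/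
def Separated (S : Submonoid ℂ[X]) : Prop :=
  ∀ F : ℂ[X] → ℂ, (∀ g, F g ≠ 0 → g ∈ S) → (∀ T : Finset ℂ[X], ∑ g ∈ T, ‖F g‖ ≤ 1 / 2) →
    ¬ ∀ᶠ z in 𝓝 (0 : ℂ), ∑' g, F g * g.eval z = z

/-- The elements of `S` are bounded by `1` on the disc of radius `r` and tend to `0` uniformly
there along the cofinite filter. -/
structure SmallOn (S : Submonoid ℂ[X]) (r : ℝ) : Prop where
  norm_le : ∀ g ∈ S, ∀ z : ℂ, ‖z‖ ≤ r → ‖g.eval z‖ ≤ 1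
  finite : ∀ δ : ℝ, 0 < δ → {g : ℂ[X] | g ∈ S ∧ ∃ z : ℂ, ‖z‖ ≤ r ∧ δ < ‖g.eval z‖}.Finite

/-- Shrinking the disc gives `|u| ≤ 1/2`, so `g * u ^ j` can exceed `δ` only when `g` does and `j`
is bounded: finitely many pairs. -/
theorem SmallOn.sup_powers {S : Submonoid ℂ[X]} {r : ℝ} (hr : 0 < r) (hS : SmallOn S r)
    {u : ℂ[X]} (hu : u.eval 0 = 0) :
    ∃ r' > 0, SmallOn (S ⊔ Submonoid.powers u) r' := by
  have hc : ∀ᶠ z in 𝓝 (0 : ℂ), ‖u.eval z‖ < 1 / 2 := by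
    have : Tendsto (fun z => ‖u.eval z‖) (𝓝 0) (𝓝 ‖u.eval 0‖) := u.continuous.norm.tendsto 0
    rw [hu, norm_zero] at this
    exact this.eventually_lt_const (by norm_num)
  obtain ⟨s, hs, hsu⟩ := Metric.eventually_nhds_iff_ball.1 hc
  have hu' : ∀ z : ℂ, ‖z‖ ≤ min r (s / 2) → ‖u.eval z‖ ≤ 1 / 2 := fun z hz =>
    (hsu z (by rw [mem_ball_zero_iff]; linarith [hz.trans (min_le_right r (s / 2))])).le
  refine ⟨min r (s / 2), lt_min hr (by linarith), ?_, ?_⟩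
  · intro g hg z hz
    obtain ⟨g, hgS, _, ⟨j, rfl⟩, rfl⟩ := Submonoid.mem_sup.1 hg
    simp only [eval_mul, eval_pow, norm_mul, norm_pow]
    exact mul_le_one₀ (hS.norm_le g hgS z (hz.trans (min_le_left _ _))) (by positivity)
      (pow_le_one₀ (norm_nonneg _) ((hu' z hz).trans (by norm_num)))
  · intro δ hδ
    obtain ⟨n, hn⟩ := exists_pow_lt_of_lt_one hδ (by norm_num : (1 / 2 : ℝ) < 1)
    refine (((hS.finite δ hδ).prod (Set.finite_Iio n)).image
      fun x : ℂ[X] × ℕ => x.1 * u ^ x.2).subset ?_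
    rintro _ ⟨hg, z, hz, hlt⟩
    obtain ⟨g, hgS, _, ⟨j, rfl⟩, rfl⟩ := Submonoid.mem_sup.1 hg
    simp only [eval_mul, eval_pow, norm_mul, norm_pow] at hlt
    have h1 := hS.norm_le g hgS z (hz.trans (min_le_left _ _))
    have h2 : ‖u.eval z‖ ^ j ≤ (1 / 2) ^ j := pow_le_pow_left₀ (norm_nonneg _) (hu' z hz) j
    have h3 : ((1 : ℝ) / 2) ^ j ≤ 1 := pow_le_one₀ (by norm_num) (by norm_num)
    refine ⟨(g, j), ⟨⟨hgS, z, hz.trans (min_le_left _ _), ?_⟩, ?_⟩, rfl⟩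
    · exact hlt.trans_le (mul_le_of_le_one_right (norm_nonneg _) (h2.trans h3))
    · by_contra hj
      have h4 : ((1 : ℝ) / 2) ^ j ≤ (1 / 2) ^ n :=
        pow_le_pow_of_le_one (by norm_num) (by norm_num) (not_lt.1 hj)
      have : ‖g.eval z‖ * ‖u.eval z‖ ^ j ≤ ‖u.eval z‖ ^ j :=
        mul_le_of_le_one_left (by positivity) h1
      linarith

theorem smallOn_bot {r : ℝ} : SmallOn ⊥ r where
  norm_le g hg z _ := by rw [Submonoid.mem_bot.1 hg]; simp
  finite δ _ := (Set.finite_singleton (1 : ℂ[X])).subset fun g hg => Submonoid.mem_bot.1 hg.1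

/-- `Ω` may be disconnected; the segment from 0 to `w` is the connected set along which the identity
theorem carries the equality. -/
theorem eqOn_segment {F : ℂ[X] → ℂ} {C : ℝ}
    (hF : ∀ T : Finset ℂ[X], ∑ g ∈ T, ‖F g‖ ≤ C) {Ω : Set ℂ} (hΩ : IsOpen Ω)
    (h : ∀ g, F g ≠ 0 → ∀ z ∈ Ω, ‖g.eval z‖ ≤ 1)
    (h0 : ∀ᶠ z in 𝓝 (0 : ℂ), ∑' g, F g * g.eval z = z) {w : ℂ}
    (hw : ∀ t : ℝ, 0 ≤ t → t ≤ 1 → (t : ℂ) * w ∈ Ω) :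
    ∑' g, F g * g.eval w = w := by
  set I : Set ℂ := (fun t : ℝ => (t : ℂ) * w) '' Set.Icc 0 1
  have hI : IsPreconnected I := isPreconnected_Icc.image _ (by fun_prop)
  have hIΩ : I ⊆ Ω := by rintro _ ⟨t, ht, rfl⟩; exact hw t ht.1 ht.2
  have := ((analyticOnNhd_tsum_mul_eval hF hΩ h).mono hIΩ).eqOn_of_preconnected_of_eventuallyEq
    (analyticOnNhd_id.mono (Set.subset_univ I)) hI (z₀ := 0) ⟨0, by simp, by simp⟩ h0
  exact this ⟨1, by simp, by simp⟩

/-- On the unit disc such a series is bounded by 1/2, yet it would have to equal 3/4 at 3/4. -/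
theorem separated_powers_X : Separated (Submonoid.powers (X : ℂ[X])) := by
  intro F hF hsum h0
  have hX : ∀ g, F g ≠ 0 → ∀ z ∈ Metric.ball (0 : ℂ) 1, ‖g.eval z‖ ≤ 1 := by
    intro g hg z hz
    obtain ⟨j, rfl⟩ := hF g hg
    simp only [eval_pow, eval_X, norm_pow]
    exact pow_le_one₀ (norm_nonneg _) (mem_ball_zero_iff.1 hz).le
  have hb : ∀ t : ℝ, 0 ≤ t → t ≤ 1 → (t : ℂ) * (3 / 4 : ℂ) ∈ Metric.ball (0 : ℂ) 1 := by
    intro t h0 h1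
    rw [mem_ball_zero_iff, norm_mul, Complex.norm_real, Real.norm_of_nonneg h0]
    norm_num; linarith
  have h1 := eqOn_segment hsum Metric.isOpen_ball hX h0 hb
  have h2 := (summable_mul_and_norm_tsum_sub_sum_le hsum ∅ (c := fun g => g.eval (3 / 4 : ℂ))
    (δ := 1) (fun g _ hg => hX g hg _ (by simpa using hb 1 zero_le_one le_rfl)) zero_le_one).2
  rw [h1] at h2
  norm_num at h2

/-- A compactness argument: at `w m` every term with a positive power of `u m` is negligible, so a
limit of bad expansions involves only elements of `S`. -/
theorem Separated.frequently_sup_powers {S : Submonoid ℂ[X]} {r : ℝ} (hS : Separated S)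
    (hsm : SmallOn S r) {u : ℕ → ℂ[X]} {ζ₀ : ℂ} (hζ₀ : ‖ζ₀‖ < r) {Z : Set ℂ}
    (hZ : ∃ᶠ ζ in 𝓝[≠] ζ₀, ζ ∈ Z)
    (hw : ∀ ζ ∈ Z, ∃ w : ℕ → ℂ, Tendsto w atTop (𝓝 ζ) ∧
      Tendsto (fun m => (u m).eval (w m)) atTop (𝓝 0) ∧
      ∀ᶠ m in atTop, ∀ t : ℝ, 0 ≤ t → t ≤ 1 → ‖(u m).eval (t * w m)‖ < 1) :
    ∃ᶠ m in atTop, Separated (S ⊔ Submonoid.powers (u m)) := by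
  classical
  by_contra hcon
  rw [not_frequently] at hcon
  have hex : ∀ m, ¬ Separated (S ⊔ Submonoid.powers (u m)) → ∃ F : ℂ[X] → ℂ,
      (∀ g, F g ≠ 0 → g ∈ S ⊔ Submonoid.powers (u m)) ∧
      (∀ T : Finset ℂ[X], ∑ g ∈ T, ‖F g‖ ≤ 1 / 2) ∧
      ∀ᶠ z in 𝓝 (0 : ℂ), ∑' g, F g * g.eval z = z := by
    intro m hm
    unfold Separated at hm
    push Not at hm
    exact hm
  choose! F hFS hFsum hF0 using hex
  -- An ultrafilter makes all the coefficients converge at once, although `ℂ[X]` is uncountable.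
  set U : Ultrafilter ℕ := hyperfilter ℕ
  have hU : (U : Filter ℕ) ≤ atTop := Nat.hyperfilter_le_atTop
  have hconU := hcon.filter_mono hU
  have hlim : ∀ g, ∃ l : ℂ, Tendsto (fun m => F m g) U (𝓝 l) := by
    intro g
    have hmem : Metric.closedBall (0 : ℂ) (1 / 2) ∈ U.map (fun m => F m g) := by
      rw [Ultrafilter.mem_map]
      filter_upwards [hconU] with m hm
      simpa using hFsum m hm {g}
    obtain ⟨l, -, hl⟩ := (isCompact_closedBall (0 : ℂ) (1 / 2)).ultrafilter_le_nhds'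
      (U.map fun m => F m g) hmem
    exact ⟨l, hl⟩
  choose l hl using hlim
  set G : ℂ[X] → ℂ := fun g => if g ∈ S then l g else 0 with hG
  have hGS : ∀ g, G g ≠ 0 → g ∈ S := by
    intro g hg
    by_contra h
    exact hg (by simp [hG, h])
  have hGsum : ∀ T : Finset ℂ[X], ∑ g ∈ T, ‖G g‖ ≤ 1 / 2 := by
    intro T
    have h1 : ∑ g ∈ T, ‖G g‖ ≤ ∑ g ∈ T, ‖l g‖ := Finset.sum_le_sum fun g _ => by
      by_cases h : g ∈ S <;> simp [hG, h]
    refine h1.trans (le_of_tendsto (tendsto_finsetSum T fun g _ => (hl g).norm) ?_)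
    filter_upwards [hconU] with m hm using hFsum m hm T
  have hGball : ∀ g, G g ≠ 0 → ∀ z ∈ Metric.ball (0 : ℂ) r, ‖g.eval z‖ ≤ 1 :=
    fun g hg z hz => hsm.norm_le g (hGS g hg) z (mem_ball_zero_iff.1 hz).le
  have key : ∀ ζ ∈ Z, ‖ζ‖ < r → ∑' g, G g * g.eval ζ = ζ := by
    intro ζ hζ hζr
    obtain ⟨w, hwζ, hwu, hwb⟩ := hw ζ hζ
    have hwr : ∀ᶠ m in atTop, ‖w m‖ < r := hwζ.norm.eventually_lt_const hζr
    refine eq_of_norm_sub_le_zero (le_of_forall_pos_le_add fun δ hδ => ?_)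
    -- Only finitely many elements of `S` exceed `δ` on the disc, so termwise limits suffice on `E`;
    -- everything else is a uniform error.
    set E : Finset ℂ[X] := (hsm.finite δ hδ).toFinset
    have hE : ∀ g ∈ S, g ∉ E → ∀ z : ℂ, ‖z‖ ≤ r → ‖g.eval z‖ ≤ δ := by
      intro g hg hgE z hz
      by_contra h
      exact hgE ((hsm.finite δ hδ).mem_toFinset.2 ⟨hg, z, hz, not_le.1 h⟩)
    have h1 : ‖∑' g, G g * g.eval ζ - ∑ g ∈ E, G g * g.eval ζ‖ ≤ 1 / 2 * δ :=
      (summable_mul_and_norm_tsum_sub_sum_le hGsum E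
        (fun g hgE hg => hE g (hGS g hg) hgE ζ hζr.le) hδ.le).2
    have h2 : ∀ᶠ m in (U : Filter ℕ),
        ‖w m - ∑ g ∈ E, F m g * g.eval (w m)‖ ≤ 1 / 2 * (δ + ‖(u m).eval (w m)‖) := by
      filter_upwards [hconU, hwr.filter_mono hU, hwb.filter_mono hU] with m hm hmr hmb
      have hΩ : IsOpen {z : ℂ | ‖z‖ < r ∧ ‖(u m).eval z‖ < 1} :=
        (isOpen_lt continuous_norm continuous_const).inter
          (isOpen_lt (u m).continuous.norm continuous_const)
      -- The bad expansion, valid near 0, is continued to `w m` inside the region where all elements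
      -- of the enlarged monoid are bounded by 1.
      have hseg := eqOn_segment (hFsum m hm) hΩ (w := w m) ?_ (hF0 m hm) ?_
      · have := (summable_mul_and_norm_tsum_sub_sum_le (hFsum m hm) E
          (c := fun g => g.eval (w m)) (δ := δ + ‖(u m).eval (w m)‖) ?_ (by positivity)).2
        · rwa [hseg] at this
        · intro g hgE hg
          have hu1 : ‖(u m).eval (w m)‖ < 1 := by simpa using hmb 1 zero_le_one le_rfl
          obtain ⟨g, hgS, _, ⟨j, rfl⟩, rfl⟩ := Submonoid.mem_sup.1 (hFS m hm g hg)
          rcases Nat.eq_zero_or_pos j with rfl | hj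
          · simp only [pow_zero, mul_one] at hgE ⊢
            exact (hE g hgS hgE _ hmr.le).trans (by linarith [norm_nonneg ((u m).eval (w m))])
          · simp only [eval_mul, eval_pow, norm_mul, norm_pow]
            have h3 := hsm.norm_le g hgS _ hmr.le
            have h4 : ‖(u m).eval (w m)‖ ^ j ≤ ‖(u m).eval (w m)‖ :=
              pow_le_of_le_one (norm_nonneg _) hu1.le hj.ne'
            have h5 : ‖g.eval (w m)‖ * ‖(u m).eval (w m)‖ ^ j ≤ ‖(u m).eval (w m)‖ ^ j :=
              mul_le_of_le_one_left (by positivity) h3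
            linarith
      · rintro g hg z ⟨hzr, hzu⟩
        obtain ⟨g, hgS, _, ⟨j, rfl⟩, rfl⟩ := Submonoid.mem_sup.1 (hFS m hm g hg)
        simp only [eval_mul, eval_pow, norm_mul, norm_pow]
        exact mul_le_one₀ (hsm.norm_le g hgS z hzr.le) (by positivity)
          (pow_le_one₀ (norm_nonneg _) hzu.le)
      · intro t ht0 ht1
        refine ⟨?_, hmb t ht0 ht1⟩
        rw [norm_mul, Complex.norm_real, Real.norm_of_nonneg ht0]
        exact (mul_le_of_le_one_left (norm_nonneg _) ht1).trans_lt hmr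
    have h3 : Tendsto (fun m => ‖w m - ∑ g ∈ E, F m g * g.eval (w m)‖) U
        (𝓝 ‖ζ - ∑ g ∈ E, G g * g.eval ζ‖) := by
      refine ((hwζ.mono_left hU).sub (tendsto_finsetSum E fun g hg => ?_)).norm
      have hgS : g ∈ S := ((hsm.finite δ hδ).mem_toFinset.1 hg).1
      simp only [hG, hgS, if_true]
      exact (hl g).mul ((g.continuous.tendsto ζ).comp (hwζ.mono_left hU))
    have h4 : Tendsto (fun m => 1 / 2 * (δ + ‖(u m).eval (w m)‖)) U (𝓝 (1 / 2 * (δ + 0))) := by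
      have := (hwu.mono_left hU).norm
      rw [norm_zero] at this
      exact (this.const_add δ).const_mul _
    have h5 := le_of_tendsto_of_tendsto h3 h4 h2
    calc ‖∑' g, G g * g.eval ζ - ζ‖
        = ‖(∑' g, G g * g.eval ζ - ∑ g ∈ E, G g * g.eval ζ)
            - (ζ - ∑ g ∈ E, G g * g.eval ζ)‖ := by congr 1; ring
      _ ≤ 1 / 2 * δ + 1 / 2 * (δ + 0) := (norm_sub_le _ _).trans (add_le_add h1 h5)
      _ = 0 + δ := by ring
  refine hS G hGS hGsum ?_
  have hr : 0 < r := (norm_nonneg _).trans_lt hζ₀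
  have hfreq : ∃ᶠ ζ in 𝓝[≠] ζ₀, ∑' g, G g * g.eval ζ = ζ := by
    have hball : ∀ᶠ ζ in 𝓝[≠] ζ₀, ‖ζ‖ < r :=
      (continuous_norm.continuousAt.eventually_lt_const hζ₀).filter_mono nhdsWithin_le_nhds
    exact (hZ.and_eventually hball).mono fun ζ h => key ζ h.1 h.2
  have heq := (analyticOnNhd_tsum_mul_eval hGsum Metric.isOpen_ball
    hGball).eqOn_of_preconnected_of_frequently_eq (analyticOnNhd_id.mono (Set.subset_univ _))
    (convex_ball (0 : ℂ) r).isPreconnected (mem_ball_zero_iff.2 hζ₀) hfreq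
  filter_upwards [Metric.ball_mem_nhds (0 : ℂ) hr] with z hz using heq hz

/-! ### Choosing the new generators. -/

theorem exists_tendsto_pow_eq {v y : ℂ} (hv : v ≠ 0) (hy : ‖y‖ = 1) :
    ∃ f : ℕ → ℂ, Tendsto f atTop (𝓝 y) ∧ ∀ m, m ≠ 0 → f m ^ m = v := by
  set b := Complex.log v
  -- The shift by `2π` makes `α` nonnegative, as the natural-number floor below requires.
  set α : ℝ := (Complex.arg y + 2 * Real.pi) / (2 * Real.pi)
  have hα : 0 ≤ α := by
    have := Complex.neg_pi_lt_arg y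
    have := Real.pi_pos
    apply div_nonneg <;> linarith
  have hπ : (2 * Real.pi : ℂ) ≠ 0 := by exact_mod_cast Real.two_pi_pos.ne'
  have hyα : Complex.exp (2 * Real.pi * Complex.I * α) = y := by
    have h1 : (2 * Real.pi * Complex.I * α : ℂ) =
        Complex.arg y * Complex.I + 2 * Real.pi * Complex.I := by
      simp only [α]
      push_cast
      field_simp
    rw [h1, Complex.exp_periodic]
    conv_rhs => rw [← Complex.norm_mul_exp_arg_mul_I y, hy]
    simp
  -- These are `m`-th roots of `v`: the modulus tends to 1, and the branch `⌊α m⌋` steers the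
  -- argument to that of `y`.
  refine ⟨fun m => Complex.exp (b / m + 2 * Real.pi * Complex.I * ((⌊α * m⌋₊ : ℝ) / (m : ℝ) : ℝ)),
    ?_, ?_⟩
  · rw [← hyα]
    refine (Complex.continuous_exp.tendsto _).comp ?_
    have h1 : Tendsto (fun m : ℕ => b / (m : ℂ)) atTop (𝓝 0) :=
      tendsto_const_div_atTop_nhds_zero_nat b
    have h2 : Tendsto (fun m : ℕ => (⌊α * m⌋₊ : ℝ) / (m : ℝ)) atTop (𝓝 α) :=
      (tendsto_nat_floor_mul_div_atTop hα).comp tendsto_natCast_atTop_atTop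
    have h3 := h1.add (((Complex.continuous_ofReal.tendsto α).comp h2).const_mul
      (2 * Real.pi * Complex.I))
    rw [zero_add] at h3
    exact h3
  · intro m hm
    have hm' : (m : ℂ) ≠ 0 := by exact_mod_cast hm
    rw [← Complex.exp_nat_mul]
    have h1 : (m : ℂ) * (b / m + 2 * Real.pi * Complex.I * ((⌊α * m⌋₊ : ℝ) / (m : ℝ) : ℝ)) =
        b + (⌊α * m⌋₊ : ℕ) * (2 * Real.pi * Complex.I) := by
      push_cast
      field_simp
    rw [h1, Complex.exp_periodic.nat_mul, Complex.exp_log hv]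

theorem tendsto_exp_mul_I_nhdsNE :
    Tendsto (fun θ : ℝ => Complex.exp (θ * Complex.I)) (𝓝[≠] 0) (𝓝[≠] 1) := by
  have hd : HasDerivAt (fun θ : ℝ => Complex.exp (θ * Complex.I)) Complex.I 0 := by
    have h1 : HasDerivAt (fun θ : ℝ => (θ : ℂ) * Complex.I) (1 * Complex.I) 0 :=
      Complex.ofRealCLM.hasDerivAt.mul_const _
    simpa using h1.cexp
  simpa using hd.tendsto_nhdsNE Complex.I_ne_zero

theorem eventually_eval_ne_zero {p : ℂ[X]} (hp : p ≠ 0) (z : ℂ) :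
    ∀ᶠ w in 𝓝[≠] z, p.eval w ≠ 0 := by
  have h : ((p.roots.toFinset : Set ℂ)ᶜ) ∪ {z} ∈ 𝓝 z := by
    have : ((p.roots.toFinset : Set ℂ) \ {z})ᶜ ∈ 𝓝 z :=
      (p.roots.toFinset.finite_toSet.sdiff).isClosed.isOpen_compl.mem_nhds (by simp)
    filter_upwards [this] with w hw
    by_contra h
    simp only [Set.mem_union, Set.mem_compl_iff, not_or, not_not] at h
    exact hw ⟨h.1, h.2⟩
  filter_upwards [mem_nhdsWithin_of_mem_nhds h, self_mem_nhdsWithin] with w hw hwz h0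
  rcases hw with hw | hw
  · exact hw (by simpa [hp] using h0)
  · exact hwz hw

theorem frequently_separated_pow {S : Submonoid ℂ[X]} {r : ℝ} (hr : 0 < r) (hS : Separated S)
    (hsm : SmallOn S r) {p : ℂ[X]} (hp : p ≠ 0) (hp0 : p.eval 0 = 0) {ε : ℝ} (hε : 0 < ε) :
    ∃ s : ℂ, ∃ᶠ n : ℕ in atTop,
      Separated (S ⊔ Submonoid.powers (C (ε⁻¹ : ℂ) * (C (s ^ n) * X ^ n - p))) := by
  have hc : ∀ᶠ z in 𝓝 (0 : ℂ), ‖p.eval z‖ < ε / 2 := by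
    have : Tendsto (fun z => ‖p.eval z‖) (𝓝 0) (𝓝 ‖p.eval 0‖) := p.continuous.norm.tendsto 0
    rw [hp0, norm_zero] at this
    exact this.eventually_lt_const (by positivity)
  obtain ⟨s₀, hs₀, hp2⟩ := Metric.eventually_nhds_iff_ball.1 hc
  obtain ⟨s, hs, hsr⟩ := exists_between (lt_min hr hs₀)
  have hs' : (s : ℂ) ≠ 0 := by exact_mod_cast hs.ne'
  have hpb : ∀ z : ℂ, ‖z‖ < s₀ → ‖p.eval z‖ < ε / 2 := fun z hz =>
    hp2 z (mem_ball_zero_iff.2 hz)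
  -- On the circle `|ζ| = s` the function `(z / s) ^ m` takes the value `p ζ` at points tending to
  -- `ζ`, provided `p ζ ≠ 0`.
  refine ⟨(s : ℂ)⁻¹, hS.frequently_sup_powers hsm (ζ₀ := s)
    (Z := {ζ | ‖ζ‖ = s ∧ p.eval ζ ≠ 0}) ?_ ?_ ?_⟩
  · rw [Complex.norm_real, Real.norm_of_nonneg hs.le]
    exact hsr.trans_le (min_le_left _ _)
  · have h1 : Tendsto (fun θ : ℝ => (s : ℂ) * Complex.exp (θ * Complex.I)) (𝓝[≠] 0)
        (𝓝[≠] (s : ℂ)) := by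
      have : Tendsto (fun z : ℂ => (s : ℂ) * z) (𝓝[≠] 1) (𝓝[≠] (s : ℂ)) := by
        have hd : HasDerivAt (fun z : ℂ => (s : ℂ) * z) (s * 1) 1 := (hasDerivAt_id 1).const_mul _
        simpa using hd.tendsto_nhdsNE (by simpa using hs')
      exact this.comp tendsto_exp_mul_I_nhdsNE
    refine h1.frequently (Eventually.frequently ?_)
    filter_upwards [h1.eventually (eventually_eval_ne_zero hp s)] with θ hθ
    exact ⟨by simp [Complex.norm_exp_ofReal_mul_I, abs_of_pos hs], hθ⟩
  · rintro ζ ⟨hζs, hζp⟩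
    obtain ⟨f, hf, hfp⟩ := exists_tendsto_pow_eq hζp (y := (s : ℂ)⁻¹ * ζ)
      (by simp [hζs, abs_of_pos hs, hs.ne'])
    have hw : Tendsto (fun m => (s : ℂ) * f m) atTop (𝓝 ζ) := by
      simpa [mul_inv_cancel_left₀ hs'] using hf.const_mul (s : ℂ)
    have hev : ∀ m, m ≠ 0 → ∀ t : ℂ,
        (C (ε⁻¹ : ℂ) * (C ((s : ℂ)⁻¹ ^ m) * X ^ m - p)).eval (t * (s * f m)) =
          (ε : ℂ)⁻¹ * (t ^ m * p.eval ζ - p.eval (t * (s * f m))) := by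
      intro m hm t
      simp only [eval_mul, eval_C, eval_sub, eval_pow, eval_X, mul_pow, hfp m hm, inv_pow]
      field_simp
    refine ⟨fun m => s * f m, hw, ?_, ?_⟩
    · have h1 : Tendsto (fun m => (ε : ℂ)⁻¹ * (p.eval ζ - p.eval (s * f m))) atTop
          (𝓝 ((ε : ℂ)⁻¹ * (p.eval ζ - p.eval ζ))) :=
        (((p.continuous.tendsto ζ).comp hw).const_sub _).const_mul _
      rw [sub_self, mul_zero] at h1
      refine h1.congr' ?_
      filter_upwards [eventually_ne_atTop 0] with m hm
      simpa using (hev m hm 1).symm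
    · have hζs₀ : ‖ζ‖ < s₀ := hζs ▸ hsr.trans_le (min_le_right _ _)
      filter_upwards [eventually_ne_atTop 0, hw.norm.eventually_lt_const hζs₀] with m hm hwm t h0 h1
      rw [hev m hm, norm_mul, norm_inv, Complex.norm_real, Real.norm_of_nonneg hε.le,
        inv_mul_lt_iff₀ hε, mul_one]
      -- Both `t ^ m * p ζ` and the value of `p` on the segment are below `ε / 2`.
      refine (norm_sub_le _ _).trans_lt ?_
      have h2 : ‖(t : ℂ) ^ m * p.eval ζ‖ ≤ ‖p.eval ζ‖ := by
        rw [norm_mul, norm_pow, Complex.norm_real, Real.norm_of_nonneg h0]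
        exact mul_le_of_le_one_left (norm_nonneg _) (pow_le_one₀ h0 h1)
      have h3 : ‖(t : ℂ) * (s * f m)‖ < s₀ := by
        rw [norm_mul, Complex.norm_real, Real.norm_of_nonneg h0]
        exact (mul_le_of_le_one_left (norm_nonneg _) h1).trans_lt hwm
      linarith [hpb _ h3, hpb ζ hζs₀]

theorem frequently_separated_one_add_pow {S : Submonoid ℂ[X]} {r : ℝ} (hr : 0 < r)
    (hS : Separated S) (hsm : SmallOn S r) {p : ℂ[X]} (hp : p ≠ 0) (hp0 : p.eval 0 = 0)
    {ε : ℝ} (hε : 0 < ε) :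
    ∃ᶠ m : ℕ in atTop,
      Separated (S ⊔ Submonoid.powers (C (ε⁻¹ : ℂ) * ((1 + X) ^ m * X - p))) := by
  obtain ⟨q, rfl⟩ : X ∣ p := X_dvd_iff.2 (by rw [coeff_zero_eq_eval_zero, hp0])
  have hq : q ≠ 0 := right_ne_zero_of_mul hp
  -- `K` must dominate both `|q|` near 0 and the constant 1, because of the maximum used below.
  set K : ℝ := ‖q.eval 0‖ + 1
  have hK : 1 ≤ K := by simp [K]
  have hc : ∀ᶠ z in 𝓝 (0 : ℂ), ‖q.eval z‖ < K ∧ ‖z‖ < ε / (2 * K) :=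
    ((q.continuous.norm.tendsto 0).eventually_lt_const (by simp [K])).and
      ((continuous_norm.tendsto' (0 : ℂ) 0 norm_zero).eventually_lt_const (by positivity))
  obtain ⟨s, hs, hq2⟩ := Metric.eventually_nhds_iff_ball.1 hc
  have hqK : ∀ z : ℂ, ‖z‖ < s → ‖q.eval z‖ ≤ K := fun z hz =>
    (hq2 z (mem_ball_zero_iff.2 hz)).1.le
  have hzε : ∀ z : ℂ, ‖z‖ < s → K * ‖z‖ < ε / 2 := fun z hz => by
    have := (lt_div_iff₀ (by positivity)).1 (hq2 z (mem_ball_zero_iff.2 hz)).2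
    linarith
  -- Here `p = X * q`, and the circle `|1 + ζ| = 1` passes through 0. Near a point of it `(1 + z) ^
  -- m = q ζ` is solvable, and then `(1 + z) ^ m * z` is close to `p z`.
  refine hS.frequently_sup_powers hsm (ζ₀ := 0)
    (Z := {ζ | ‖1 + ζ‖ = 1 ∧ q.eval ζ ≠ 0 ∧ ‖ζ‖ < s}) (by simpa using hr) ?_ ?_
  · have h1 : Tendsto (fun θ : ℝ => Complex.exp (θ * Complex.I) - 1) (𝓝[≠] 0) (𝓝[≠] (0 : ℂ)) := by
      have : Tendsto (fun z : ℂ => z - 1) (𝓝[≠] 1) (𝓝[≠] (0 : ℂ)) := by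
        have hd : HasDerivAt (fun z : ℂ => z - 1) 1 1 := (hasDerivAt_id 1).sub_const _
        simpa using hd.tendsto_nhdsNE one_ne_zero
      exact this.comp tendsto_exp_mul_I_nhdsNE
    refine h1.frequently (Eventually.frequently ?_)
    have h2 : ∀ᶠ z in 𝓝[≠] (0 : ℂ), ‖z‖ < s :=
      ((continuous_norm.tendsto' (0 : ℂ) 0 norm_zero).eventually_lt_const hs).filter_mono
        nhdsWithin_le_nhds
    filter_upwards [h1.eventually (eventually_eval_ne_zero hq 0), h1.eventually h2] with θ hθ hθs
    exact ⟨by simp [Complex.norm_exp_ofReal_mul_I], hθ, hθs⟩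
  · rintro ζ ⟨hζ1, hζq, hζs⟩
    obtain ⟨f, hf, hfp⟩ := exists_tendsto_pow_eq hζq hζ1
    have hw : Tendsto (fun m => f m - 1) atTop (𝓝 ζ) := by
      simpa using hf.sub_const 1
    refine ⟨fun m => f m - 1, hw, ?_, ?_⟩
    · have h1 : Tendsto (fun m => (ε : ℂ)⁻¹ * ((q.eval ζ - q.eval (f m - 1)) * (f m - 1))) atTop
          (𝓝 ((ε : ℂ)⁻¹ * ((q.eval ζ - q.eval ζ) * ζ))) :=
        ((((q.continuous.tendsto ζ).comp hw).const_sub _).mul hw).const_mul _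
      rw [sub_self, zero_mul, mul_zero] at h1
      refine h1.congr' ?_
      filter_upwards [eventually_ne_atTop 0] with m hm
      simp only [eval_mul, eval_C, eval_sub, eval_pow, eval_X, eval_add, eval_one,
        add_sub_cancel, hfp m hm]
      ring
    · filter_upwards [eventually_ne_atTop 0, hw.norm.eventually_lt_const hζs] with m hm hwm t h0 h1
      set w := f m - 1 with hwdef
      have htn : ‖(t : ℂ) * w‖ ≤ ‖w‖ := by
        rw [norm_mul, Complex.norm_real, Real.norm_of_nonneg h0]
        exact mul_le_of_le_one_left (norm_nonneg _) h1
      -- By convexity `|1 + t w| ≤ max 1 |f m|`, and `|f m| ^ m = |q ζ| ≤ K`.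
      have hpow : ‖1 + (t : ℂ) * w‖ ^ m ≤ K := by
        have h2 : ‖1 + (t : ℂ) * w‖ ≤ max 1 ‖f m‖ := by
          have : 1 + (t : ℂ) * w = ((1 - t : ℝ) : ℂ) * 1 + (t : ℂ) * f m := by
            rw [hwdef]; push_cast; ring
          rw [this]
          refine (norm_add_le _ _).trans ?_
          rw [norm_mul, norm_mul, Complex.norm_real, Complex.norm_real, norm_one,
            Real.norm_of_nonneg h0, Real.norm_of_nonneg (by linarith)]
          calc (1 - t) * 1 + t * ‖f m‖
              ≤ (1 - t) * max 1 ‖f m‖ + t * max 1 ‖f m‖ := by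
                gcongr
                · exact le_max_left _ _
                · exact le_max_right _ _
            _ = max 1 ‖f m‖ := by ring
        refine (pow_le_pow_left₀ (norm_nonneg _) h2 m).trans ?_
        rcases max_choice 1 ‖f m‖ with h | h <;> rw [h]
        · simpa using hK
        · rw [← norm_pow, hfp m hm]
          exact hqK ζ hζs
      simp only [eval_mul, eval_C, eval_sub, eval_pow, eval_X, eval_add, eval_one, norm_mul,
        norm_inv, Complex.norm_real, Real.norm_of_nonneg hε.le]
      rw [inv_mul_lt_iff₀ hε, mul_one]
      refine (norm_sub_le _ _).trans_lt ?_
      have h3 : ‖(1 + (t : ℂ) * w) ^ m * (t * w)‖ ≤ K * ‖w‖ := by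
        rw [norm_mul, norm_pow]
        gcongr
      have h4 : ‖(t : ℂ) * w * q.eval (t * w)‖ ≤ K * ‖w‖ := by
        rw [norm_mul, mul_comm]
        gcongr
        exact hqK _ (htn.trans_lt hwm)
      linarith [hzε w hwm]

/-! ### Countable iteration of the extension step. -/

/-- A submonoid to which approximation relations can still be added. -/
def Extendable (S : Submonoid ℂ[X]) : Prop :=
  Separated S ∧ ∃ r > 0, SmallOn S r

theorem extendable_powers_X : Extendable (Submonoid.powers (X : ℂ[X])) := by
  refine ⟨separated_powers_X, ?_⟩
  obtain ⟨r, hr, h⟩ := (smallOn_bot (r := 1)).sup_powers one_pos (u := X) (by simp)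
  exact ⟨r, hr, by simpa using h⟩

/-- `p` is approximated up to `ε` by a multiple of a power of `X` and by some `(1 + X) ^ m * X`,
the normalized differences being in `S`. -/
def Approximates (S : Submonoid ℂ[X]) (p : ℂ[X]) (ε : ℝ) : Prop :=
  (∃ (c : ℂ) (n : ℕ), 1 ≤ n ∧ C (ε⁻¹ : ℂ) * (C c * X ^ n - p) ∈ S) ∧
    ∃ m : ℕ, 1 ≤ m ∧ C (ε⁻¹ : ℂ) * ((1 + X) ^ m * X - p) ∈ S

theorem Extendable.exists_approximates {S : Submonoid ℂ[X]} (hS : Extendable S) {p : ℂ[X]}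
    (hp : p ≠ 0) (hp0 : p.eval 0 = 0) {ε : ℝ} (hε : 0 < ε) :
    ∃ S', S ≤ S' ∧ Extendable S' ∧ Approximates S' p ε := by
  obtain ⟨hsep, r, hr, hsm⟩ := hS
  obtain ⟨s, hs⟩ := frequently_separated_pow hr hsep hsm hp hp0 hε
  obtain ⟨n, hsep1, hn⟩ := (hs.and_eventually (eventually_ge_atTop 1)).exists
  obtain ⟨r1, hr1, hsm1⟩ := hsm.sup_powers hr
    (u := C (ε⁻¹ : ℂ) * (C (s ^ n) * X ^ n - p)) (by simp [hp0, zero_pow (by omega : n ≠ 0)])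
  obtain ⟨m, hsep2, hm⟩ := ((frequently_separated_one_add_pow hr1 hsep1 hsm1 hp hp0
    hε).and_eventually (eventually_ge_atTop 1)).exists
  obtain ⟨r2, hr2, hsm2⟩ := hsm1.sup_powers hr1
    (u := C (ε⁻¹ : ℂ) * ((1 + X) ^ m * X - p)) (by simp [hp0])
  exact ⟨_, le_sup_left.trans le_sup_left, ⟨hsep2, r2, hr2, hsm2⟩,
    ⟨_, n, hn, le_sup_left (α := Submonoid ℂ[X])
      (le_sup_right (α := Submonoid ℂ[X]) (Submonoid.mem_powers _))⟩,
    m, hm, le_sup_right (α := Submonoid ℂ[X]) (Submonoid.mem_powers _)⟩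

theorem Approximates.mono {S S' : Submonoid ℂ[X]} (h : S ≤ S') {p : ℂ[X]} {ε : ℝ}
    (hS : Approximates S p ε) : Approximates S' p ε := by
  obtain ⟨⟨c, n, hn, h1⟩, m, hm, h2⟩ := hS
  exact ⟨⟨c, n, hn, h h1⟩, m, hm, h h2⟩

theorem exists_submonoid_approximates {D : Set ℂ[X]} (hD : D.Countable)
    (hD0 : ∀ p ∈ D, p ≠ 0 ∧ p.eval 0 = 0) :
    ∃ S : Submonoid ℂ[X], X ∈ S ∧
      (∀ {ι : Type} [Fintype ι] (d : ι → ℂ) (g : ι → ℂ[X]), (∀ i, g i ∈ S) →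
        ∑ i, d i • g i = X → 1 / 2 < ∑ i, ‖d i‖) ∧
      ∀ p ∈ D, ∀ k : ℕ, Approximates S p (1 / (k + 1)) := by
  classical
  have : Countable (D × ℕ) := by have := hD.to_subtype; infer_instance
  -- `Option` guarantees a nonempty type to enumerate; `none` means that nothing is added.
  obtain ⟨e, he⟩ : ∃ e : ℕ → Option (D × ℕ), Function.Surjective e := exists_surjective_nat _
  have step : ∀ (x : Option (D × ℕ)) (S : {S : Submonoid ℂ[X] // Extendable S}),
      ∃ S' : {S : Submonoid ℂ[X] // Extendable S}, S.1 ≤ S'.1 ∧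
        ∀ y ∈ x, Approximates S'.1 y.1 (1 / ((y.2 : ℝ) + 1)) := by
    rintro (_ | ⟨⟨p, hp⟩, k⟩) ⟨S, hS⟩
    · exact ⟨⟨S, hS⟩, le_rfl, by simp⟩
    · obtain ⟨S', h1, h2, h3⟩ := hS.exists_approximates (hD0 p hp).1 (hD0 p hp).2
        (ε := 1 / ((k : ℝ) + 1)) (by positivity)
      refine ⟨⟨S', h2⟩, h1, ?_⟩
      rintro y ⟨⟩
      exact h3
  choose next hle happ using step
  let T : ℕ → {S : Submonoid ℂ[X] // Extendable S} := fun n =>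
    Nat.rec ⟨_, extendable_powers_X⟩ (fun n S => next (e n) S) n
  have hT : Monotone fun n => (T n).1 := monotone_nat_of_le_succ fun n => hle (e n) (T n)
  have hmem : ∀ {g : ℂ[X]}, g ∈ (⨆ n, (T n).1) ↔ ∃ n, g ∈ (T n).1 :=
    Submonoid.mem_iSup_of_directed hT.directed_le
  refine ⟨⨆ n, (T n).1, hmem.2 ⟨0, Submonoid.mem_powers _⟩, ?_, ?_⟩
  · intro ι _ d g hg hX
    obtain ⟨N, hN⟩ : ∃ N, ∀ i, g i ∈ (T N).1 := by
      choose n hn using fun i => hmem.1 (hg i)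
      exact ⟨Finset.univ.sup n, fun i => hT (Finset.le_sup (Finset.mem_univ i)) (hn i)⟩
    by_contra hcon
    -- The `g i` may coincide, so their coefficients are first collected; this does not increase the
    -- `ℓ¹`-norm.
    refine (T N).2.1 (fun h => ∑ i, if g i = h then d i else 0) (fun h hh => ?_) (fun A => ?_)
      (Eventually.of_forall fun z => ?_)
    · obtain ⟨i, -, hi⟩ := Finset.exists_ne_zero_of_sum_ne_zero hh
      have : g i = h := by by_contra hne; exact hi (if_neg hne)
      exact this ▸ hN i
    · calc ∑ h ∈ A, ‖∑ i, if g i = h then d i else 0‖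
          ≤ ∑ h ∈ A, ∑ i, if g i = h then ‖d i‖ else 0 := Finset.sum_le_sum fun h _ =>
            (norm_sum_le _ _).trans_eq (Finset.sum_congr rfl fun i _ => by split_ifs <;> simp)
        _ = ∑ i, ∑ h ∈ A, if g i = h then ‖d i‖ else 0 := Finset.sum_comm
        _ ≤ ∑ i, ‖d i‖ := Finset.sum_le_sum fun i _ => by
            rw [Finset.sum_ite_eq]; split_ifs <;> simp
        _ ≤ 1 / 2 := not_lt.1 hcon
    · rw [tsum_eq_sum (s := Finset.univ.image g) fun h hh => by
        rw [Finset.sum_eq_zero, zero_mul]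
        intro i _
        exact if_neg fun hi : g i = h => hh (hi ▸ Finset.mem_image_of_mem g (Finset.mem_univ i))]
      simp_rw [Finset.sum_mul, ite_mul, zero_mul]
      rw [Finset.sum_comm]
      simp only [Finset.sum_ite_eq, Finset.mem_image_of_mem g (Finset.mem_univ _), if_true]
      have := congrArg (eval z) hX
      simpa [eval_finsetSum] using this
  · intro p hp k
    obtain ⟨n, hn⟩ := he (some (⟨p, hp⟩, k))
    exact (happ (e n) (T n) (⟨p, hp⟩, k) (by rw [hn]; rfl)).mono (le_iSup (fun n => (T n).1) (n + 1))

/-! ### From a submonoid to a Banach algebra. -/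

/-- Separated completion also kills the null space, so `ν` need not be a norm. -/
theorem exists_banachAlgebra_of_seminorm {R : Type} [CommRing R] [Algebra ℂ R] (ν : Seminorm ℂ R)
    (hν : ∀ f g, ν (f * g) ≤ ν f * ν g) :
    ∃ (B : Type) (_ : NormedCommRing B) (_ : NormedAlgebra ℂ B) (_ : CompleteSpace B)
      (φ : R →ₐ[ℂ] B), DenseRange φ ∧ ∀ f, ‖φ f‖ = ν f := by
  let : SeminormedCommRing R :=
    { RingSeminorm.toSeminormedRing
        { toFun := ν
          map_zero' := map_zero ν
          add_le' := map_add_le_add ν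
          neg' := map_neg_eq_map ν
          mul_le' := hν } with
      mul_comm := mul_comm }
  let : NormedAlgebra ℂ R := { (inferInstance : Algebra ℂ R) with
    norm_smul_le := fun c f => (map_smul_eq_mul ν c f).le }
  refine ⟨UniformSpace.Completion R, inferInstance, inferInstance, inferInstance,
    { UniformSpace.Completion.coeRingHom with commutes' := fun c => rfl },
    UniformSpace.Completion.denseRange_coe, fun f => UniformSpace.Completion.norm_coe f⟩

/-- The convex hull of the multiples of elements of `S` by complex numbers of modulus at most
`1`. -/
def unitHull (S : Submonoid ℂ[X]) : Set ℂ[X] :=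
  convexHull ℝ {f | ∃ c : ℂ, ‖c‖ ≤ 1 ∧ ∃ g ∈ S, c • g = f}

theorem smul_mem_unitHull {S : Submonoid ℂ[X]} {c : ℂ} (hc : ‖c‖ ≤ 1) {g : ℂ[X]} (hg : g ∈ S) :
    c • g ∈ unitHull S :=
  subset_convexHull ℝ _ ⟨c, hc, g, hg, rfl⟩

theorem unitHull_subset {S : Submonoid ℂ[X]} {s : Set ℂ[X]} (hs : Convex ℝ s)
    (h : ∀ c : ℂ, ‖c‖ ≤ 1 → ∀ g ∈ S, c • g ∈ s) : unitHull S ⊆ s :=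
  convexHull_min (by rintro _ ⟨c, hc, g, hg, rfl⟩; exact h c hc g hg) hs

theorem balanced_unitHull (S : Submonoid ℂ[X]) : Balanced ℂ (unitHull S) := by
  rw [balanced_iff_smul_mem]
  intro a ha f hf
  refine unitHull_subset (s := (LinearMap.lsmul ℂ ℂ[X] a).restrictScalars ℝ ⁻¹' unitHull S)
    ((convex_convexHull ℝ _).linear_preimage _) (fun c hc g hg => ?_) hf
  change a • c • g ∈ unitHull S
  rw [smul_smul]
  exact smul_mem_unitHull (by rw [norm_mul]; exact mul_le_one₀ ha (norm_nonneg _) hc) hg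

theorem mul_mem_unitHull {S : Submonoid ℂ[X]} {f g : ℂ[X]} (hf : f ∈ unitHull S)
    (hg : g ∈ unitHull S) : f * g ∈ unitHull S := by
  have h1 : ∀ p ∈ S, ∀ h ∈ unitHull S, p * h ∈ unitHull S := by
    intro p hp h hh
    refine unitHull_subset (s := (LinearMap.mulLeft ℂ p).restrictScalars ℝ ⁻¹' unitHull S)
      ((convex_convexHull ℝ _).linear_preimage _) (fun c hc q hq => ?_) hh
    change p * (c • q) ∈ unitHull S
    rw [mul_smul_comm]
    exact smul_mem_unitHull hc (S.mul_mem hp hq)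
  refine unitHull_subset (s := (LinearMap.mulRight ℂ g).restrictScalars ℝ ⁻¹' unitHull S)
      ((convex_convexHull ℝ _).linear_preimage _) (fun c hc q hq => ?_) hf
  change (c • q) * g ∈ unitHull S
  rw [smul_mul_assoc]
  exact (balanced_iff_smul_mem.1 (balanced_unitHull S)) hc (h1 q hq g hg)

theorem absorbent_unitHull {S : Submonoid ℂ[X]} (hX : X ∈ S) : Absorbent ℝ (unitHull S) := by
  have hmem : ∀ f : ℂ[X], ∃ t : ℝ, 0 < t ∧ t • f ∈ unitHull S := by
    intro f
    induction f using Polynomial.induction_on' with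
    | add p q hp hq =>
      obtain ⟨t, ht, htp⟩ := hp
      obtain ⟨s, hs, hsq⟩ := hq
      refine ⟨t * s / (t + s), by positivity, ?_⟩
      have := (convex_convexHull ℝ _) htp hsq (a := s / (t + s)) (b := t / (t + s))
        (by positivity) (by positivity) (by field_simp; ring)
      rw [smul_smul, smul_smul] at this
      rw [smul_add]
      change _ ∈ unitHull S at this
      convert this using 3 <;> ring
    | monomial n a =>
      refine ⟨(‖a‖ + 1)⁻¹, by positivity, ?_⟩
      have := smul_mem_unitHull (S := S) (c := ((‖a‖ + 1)⁻¹ : ℝ) * a) (g := X ^ n) ?_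
        (S.pow_mem hX n)
      · convert this using 1
        rw [← C_mul_X_pow_eq_monomial, ← smul_eq_C_mul, mul_smul]
        exact (Complex.coe_smul _ _).symm
      · rw [norm_mul, Complex.norm_real, Real.norm_of_nonneg (by positivity),
          inv_mul_le_iff₀ (by positivity)]
        linarith
  intro f
  obtain ⟨t, ht, htf⟩ := hmem f
  rw [absorbs_iff_eventually_cobounded_mapsTo]
  filter_upwards [tendsto_norm_cobounded_atTop.eventually_ge_atTop t⁻¹] with r hr
  rw [Set.mapsTo_singleton]
  have hb := balanced_iff_smul_mem.1 (balanced_unitHull S)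
    (show ‖((r⁻¹ * t⁻¹ : ℝ) : ℂ)‖ ≤ 1 from ?_) htf
  · rw [Complex.coe_smul, smul_smul] at hb
    convert hb using 2
    field_simp
  · rw [Complex.norm_real, norm_mul, norm_inv, Real.norm_of_nonneg (inv_pos.2 ht).le]
    have : 0 < ‖r‖ := (inv_pos.2 ht).trans_le hr
    rw [inv_mul_le_iff₀ this]
    linarith

/-- The gauge of `unitHull S` works. If it vanished at `X`, then `X` would lie in `b • unitHull S`
with `b < 1/2`, an expansion that is too cheap for `hS`. -/
theorem exists_seminorm_of_submonoid {S : Submonoid ℂ[X]} (hX : X ∈ S)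
    (hS : ∀ {ι : Type} [Fintype ι] (d : ι → ℂ) (g : ι → ℂ[X]), (∀ i, g i ∈ S) →
        ∑ i, d i • g i = X → 1 / 2 < ∑ i, ‖d i‖) :
    ∃ ν : Seminorm ℂ ℂ[X], (∀ f g, ν (f * g) ≤ ν f * ν g) ∧ (∀ g ∈ S, ν g ≤ 1) ∧ ν X ≠ 0 := by
  have hab := absorbent_unitHull hX
  refine ⟨gaugeSeminorm (balanced_unitHull S) (convex_convexHull ℝ _) hab, ?_, ?_, ?_⟩
  · intro f g
    change gauge (unitHull S) _ ≤ gauge (unitHull S) f * gauge (unitHull S) g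
    refine le_mul_of_forall_lt₀ fun a ha b hb => ?_
    obtain ⟨a', ha', haa, p, hp, rfl⟩ := exists_lt_of_gauge_lt hab ha
    obtain ⟨b', hb', hbb, q, hq, rfl⟩ := exists_lt_of_gauge_lt hab hb
    calc gauge (unitHull S) (a' • p * b' • q) ≤ a' * b' :=
          gauge_le_of_mem (by positivity) ⟨p * q, mul_mem_unitHull hp hq, by
            change (a' * b') • (p * q) = _
            rw [smul_mul_smul_comm]⟩
      _ ≤ a * b := mul_le_mul haa.le hbb.le hb'.le (ha'.le.trans haa.le)
  · intro g hg
    exact gauge_le_one_of_mem (by simpa using smul_mem_unitHull (c := 1) (by simp) hg)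
  · intro h0
    have hlt : gauge (unitHull S) X < 1 / 2 := by
      change gauge (unitHull S) X = 0 at h0
      rw [h0]; norm_num
    obtain ⟨b, hb, hb2, f, hf, hfX⟩ := exists_lt_of_gauge_lt hab hlt
    obtain ⟨ι, _, w, z, hw0, hw1, hz, hwz⟩ := mem_convexHull_iff_exists_fintype.1 hf
    choose c hc g hg hcg using hz
    have := hS (fun i => b * (w i * c i)) g hg ?_
    · have h2 : ∑ i, ‖(b : ℂ) * (w i * c i)‖ ≤ ∑ i, b * w i := Finset.sum_le_sum fun i _ => by
        rw [norm_mul, norm_mul, Complex.norm_real, Complex.norm_real, Real.norm_of_nonneg hb.le,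
          Real.norm_of_nonneg (hw0 i)]
        exact mul_le_mul_of_nonneg_left (mul_le_of_le_one_right (hw0 i) (hc i)) hb.le
      rw [← Finset.mul_sum, hw1] at h2
      linarith
    · rw [← hfX, ← hwz]
      simp only [mul_smul, Complex.coe_smul, hcg, Finset.smul_sum]

/-! ### Countable density in the closed ideal and the chaotic generator. -/

theorem denseRange_ratCast_add_mul_I :
    DenseRange fun q : ℚ × ℚ => (q.1 : ℂ) + Complex.I * q.2 := by
  have h1 : DenseRange (Prod.map ((↑) : ℚ → ℝ) ((↑) : ℚ → ℝ)) :=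
    Rat.denseRange_cast.prodMap Rat.denseRange_cast
  have h2 := (Complex.equivRealProdCLM.symm.surjective.denseRange).comp h1
    Complex.equivRealProdCLM.symm.continuous
  convert h2 using 1
  funext q
  rw [Function.comp_apply, Complex.equivRealProdCLM_symm_apply]
  simp [mul_comm]

/-- The polynomials without constant term and with coefficients in `ℚ(i)`. -/
def rationalPolynomial : ℚ[X] × ℚ[X] →+ ℂ[X] :=
  (AddMonoidHom.mulLeft (X : ℂ[X])).comp <|
    ((mapRingHom (algebraMap ℚ ℂ)).toAddMonoidHom).coprod
      ((AddMonoidHom.mulLeft (C Complex.I)).comp (mapRingHom (algebraMap ℚ ℂ)).toAddMonoidHom)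

theorem rationalPolynomial_apply (q : ℚ[X] × ℚ[X]) : rationalPolynomial q =
    X * (q.1.map (algebraMap ℚ ℂ) + C Complex.I * q.2.map (algebraMap ℚ ℂ)) := rfl

theorem mem_closure_span_self {B : Type*} [NormedCommRing B] (a : B) : a ∈ (Ideal.span {a}).closure :=
  subset_closure (Ideal.mem_span_singleton_self a)

section Algebra

variable {B : Type*} [NormedCommRing B] [NormedAlgebra ℂ B]

theorem closure_span_le_closure_rationalPolynomial {φ : ℂ[X] →ₐ[ℂ] B} (hφ : DenseRange φ) :
    ((Ideal.span {φ X}).closure : Set B) ⊆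
      closure (Set.range fun q => φ (rationalPolynomial q)) := by
  set Ψ : ℚ[X] × ℚ[X] →+ B := (φ : ℂ[X] →+ B).comp rationalPolynomial
  change _ ⊆ closure (Ψ.range : Set B)
  rw [Ideal.coe_closure]
  refine closure_minimal ?_ isClosed_closure
  rw [← AddSubgroup.topologicalClosure_coe]
  set K := Ψ.range.topologicalClosure
  have hK : IsClosed (K : Set B) := isClosed_closure
  have hmon : ∀ (n : ℕ) (c : ℂ), c • φ X ^ (n + 1) ∈ K := by
    intro n c
    refine (denseRange_ratCast_add_mul_I.induction_on (p := fun c => c • φ X ^ (n + 1) ∈ K) c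
      (hK.preimage (by fun_prop)) fun q => ?_)
    refine Ψ.range.le_topologicalClosure ⟨(C q.1 * X ^ n, C q.2 * X ^ n), ?_⟩
    change φ (rationalPolynomial _) = _
    rw [rationalPolynomial_apply, ← map_pow, ← map_smul, smul_eq_C_mul]
    congr 1
    simp only [Polynomial.map_mul, map_C, Polynomial.map_pow, map_X, map_add, map_mul,
      eq_ratCast]
    ring
  have hpoly : ∀ f : ℂ[X], φ X * φ f ∈ K := by
    intro f
    induction f using Polynomial.induction_on' with
    | add p q hp hq => rw [map_add, mul_add]; exact K.add_mem hp hq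
    | monomial n c =>
      have := hmon n c
      rw [← C_mul_X_pow_eq_monomial, ← smul_eq_C_mul, map_smul, map_pow, mul_smul_comm, ← pow_succ']
      exact this
  intro x hx
  obtain ⟨y, rfl⟩ := Ideal.mem_span_singleton'.1 hx
  rw [mul_comm]
  exact hφ.induction_on (p := fun y => φ X * y ∈ K) y (hK.preimage (by fun_prop)) hpoly

/-- `a` is nonzero and both `{z a ^ n : n ≥ 1}` and `{(1 + a) ^ n a : n ≥ 1}` are dense in the
closed ideal generated by `a`. -/
structure IsChaoticGenerator (a : B) : Prop where
  ne_zero : a ≠ 0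
  pow : ∀ b ∈ (Ideal.span {a}).closure, ∀ ε > 0, ∃ (c : ℂ) (n : ℕ), 1 ≤ n ∧ ‖c • a ^ n - b‖ < ε
  one_add_pow : ∀ b ∈ (Ideal.span {a}).closure, ∀ ε > 0, ∃ n : ℕ, 1 ≤ n ∧ ‖(1 + a) ^ n * a - b‖ < ε

theorem exists_rationalPolynomial_near {φ : ℂ[X] →ₐ[ℂ] B} (hφ : DenseRange φ) (h0 : φ X ≠ 0)
    {b : B} (hb : b ∈ (Ideal.span {φ X}).closure) {ε : ℝ} (hε : 0 < ε) :
    ∃ q, rationalPolynomial q ≠ 0 ∧ ‖φ (rationalPolynomial q) - b‖ < ε := by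
  have hnear : ∃ b' ∈ (Ideal.span {φ X}).closure, b' ≠ 0 ∧ ‖b' - b‖ < ε / 2 := by
    -- The approximation relations concern nonzero polynomials only, so 0 is replaced by a small
    -- multiple of `φ X`.
    by_cases hb0 : b = 0
    · have hn : 0 < ‖φ X‖ := norm_pos_iff.2 h0
      have ht : ((ε / 4 / ‖φ X‖ : ℝ) : ℂ) ≠ 0 := by
        exact_mod_cast (by positivity : ε / 4 / ‖φ X‖ ≠ 0)
      refine ⟨((ε / 4 / ‖φ X‖ : ℝ) : ℂ) • φ X, ?_, smul_ne_zero ht h0, ?_⟩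
      · rw [Algebra.smul_def]
        exact Ideal.mul_mem_left _ _ (mem_closure_span_self _)
      · rw [hb0, sub_zero, norm_smul, Complex.norm_real, Real.norm_of_nonneg (by positivity),
          div_mul_cancel₀ _ hn.ne']
        linarith
    · exact ⟨b, hb, hb0, by simpa using hε⟩
  obtain ⟨b', hb', hb0, hbb⟩ := hnear
  have hn : 0 < ‖b'‖ := norm_pos_iff.2 hb0
  -- Distance below `‖b'‖` rules out the zero polynomial.
  obtain ⟨_, ⟨q, rfl⟩, hq⟩ := Metric.mem_closure_iff.1
    (closure_span_le_closure_rationalPolynomial hφ hb') (min (ε / 2) ‖b'‖) (by positivity)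
  rw [dist_eq_norm] at hq
  refine ⟨q, fun hq0 => ?_, ?_⟩
  · simp only [hq0, map_zero, sub_zero] at hq
    exact absurd (hq.trans_le (min_le_right _ _)) (lt_irrefl _)
  · have h1 := hq.trans_le (min_le_left _ _)
    rw [norm_sub_rev] at h1
    have := norm_add_le (φ (rationalPolynomial q) - b') (b' - b)
    rw [sub_add_sub_cancel] at this
    linarith

end Algebra

theorem exists_isChaoticGenerator :
    ∃ (B : Type) (_ : NormedCommRing B) (_ : NormedAlgebra ℂ B) (_ : CompleteSpace B) (a : B),
      IsChaoticGenerator a := by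
  have : Countable ℚ[X] := Cardinal.mk_le_aleph0_iff.1
    (cardinalMk_le_max.trans (max_le Cardinal.mk_le_aleph0 le_rfl))
  obtain ⟨S, hXS, hsep, happ⟩ := exists_submonoid_approximates
    (D := Set.range rationalPolynomial \ {0})
    ((Set.countable_range _).mono Set.sdiff_subset) (by
      rintro _ ⟨⟨q, rfl⟩, h⟩
      exact ⟨h, by simp [rationalPolynomial_apply]⟩)
  obtain ⟨ν, hν, hνS, hνX⟩ := exists_seminorm_of_submonoid hXS hsep
  obtain ⟨B, _, _, hB, φ, hφ, hφν⟩ := exists_banachAlgebra_of_seminorm ν hν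
  have h0 : φ X ≠ 0 := norm_ne_zero_iff.1 (by rwa [hφν])
  have hle : ∀ (k : ℕ) (f p : ℂ[X]), C (((1 / ((k : ℝ) + 1) : ℝ) : ℂ)⁻¹) * (f - p) ∈ S →
      ‖φ f - φ p‖ ≤ 1 / ((k : ℝ) + 1) := by
    intro k f p h
    have h1 := hνS _ h
    have hk : (0 : ℝ) < 1 / ((k : ℝ) + 1) := by positivity
    rw [← smul_eq_C_mul, map_smul_eq_mul, norm_inv, Complex.norm_real, Real.norm_of_nonneg hk.le,
      inv_mul_le_iff₀ hk, mul_one] at h1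
    rwa [← map_sub, hφν]
  refine ⟨B, inferInstance, inferInstance, hB, φ X, h0, ?_, ?_⟩
  all_goals
    intro b hb ε hε
    obtain ⟨q, hq0, hq⟩ := exists_rationalPolynomial_near hφ h0 hb (half_pos hε)
    obtain ⟨k, hk⟩ := exists_nat_one_div_lt (half_pos hε)
    obtain ⟨⟨c, n, hn, h1⟩, m, hm, h2⟩ := happ _ ⟨⟨q, rfl⟩, hq0⟩ k
  · refine ⟨c, n, hn, ?_⟩
    have h3 := hle _ _ _ h1
    rw [← smul_eq_C_mul, map_smul, map_pow] at h3
    have := norm_add_le (c • φ X ^ n - φ (rationalPolynomial q)) (φ (rationalPolynomial q) - b)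
    rw [sub_add_sub_cancel] at this
    linarith
  · refine ⟨m, hm, ?_⟩
    have h3 := hle _ _ _ h2
    rw [map_mul, map_pow, map_add, map_one] at h3
    have := norm_add_le ((1 + φ X) ^ m * φ X - φ (rationalPolynomial q))
      (φ (rationalPolynomial q) - b)
    rw [sub_add_sub_cancel] at this
    linarith

/-! ### Quasinilpotency and the logarithm. -/

/-- A geometric sequence is either bounded or, when `v ≠ 0`, bounded away from 0, hence never dense
in `ℂ`. -/
theorem not_forall_exists_one_add_pow_mul_near (l v : ℂ)
    (h : ∀ w : ℂ, ∀ ε > 0, ∃ n : ℕ, ‖(1 + l) ^ n * v - w‖ < ε) : False := by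
  by_cases hl : ‖1 + l‖ ≤ 1
  · obtain ⟨n, hn⟩ := h ((‖v‖ + 1 : ℝ) : ℂ) 1 one_pos
    have h1 : ‖(1 + l) ^ n * v‖ ≤ ‖v‖ := by
      rw [norm_mul, norm_pow]
      exact mul_le_of_le_one_left (norm_nonneg _) (pow_le_one₀ (norm_nonneg _) hl)
    have h2 := norm_sub_norm_le ((‖v‖ + 1 : ℝ) : ℂ) ((1 + l) ^ n * v)
    rw [norm_sub_rev, Complex.norm_real, Real.norm_of_nonneg (by positivity)] at h2
    linarith
  · by_cases hv : v = 0
    · obtain ⟨n, hn⟩ := h 1 1 one_pos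
      simp [hv] at hn
    · obtain ⟨n, hn⟩ := h 0 ‖v‖ (norm_pos_iff.2 hv)
      rw [sub_zero, norm_mul, norm_pow] at hn
      exact absurd hn (not_lt.2 (le_mul_of_one_le_left (norm_nonneg _)
        (one_le_pow₀ (not_le.1 hl).le)))

theorem spectralRadius_eq_zero_iff {B : Type*} [Ring B] [Algebra ℂ B] {a : B} :
    spectralRadius ℂ a = 0 ↔ ∀ k ∈ spectrum ℂ a, k = 0 := by
  simp [spectralRadius]

section Logarithm

variable {B : Type*} [NormedCommRing B] [NormedAlgebra ℂ B] [CompleteSpace B]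

/-- By Gelfand's formula `‖a ^ n‖ ≤ (2R)⁻ⁿ` eventually. -/
theorem summable_norm_pow_mul_of_spectralRadius_eq_zero {a : B} (ha : spectralRadius ℂ a = 0)
    (R : ℝ) (hR : 0 < R) : Summable fun n : ℕ => R ^ n * ‖a ^ n‖ := by
  have h1 := spectrum.pow_nnnorm_pow_one_div_tendsto_nhds_spectralRadius a
  rw [ha] at h1
  have hR' : (0 : ENNReal) < ENNReal.ofReal (2 * R)⁻¹ := by
    rw [ENNReal.ofReal_pos]; positivity
  have h2 := h1.eventually_lt_const hR'
  refine .of_norm_bounded_eventually_nat summable_geometric_two ?_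
  filter_upwards [h2, eventually_ge_atTop 1] with n hn hn1
  rw [Real.norm_of_nonneg (by positivity)]
  have h3 : ‖a ^ n‖ ≤ ((2 * R)⁻¹) ^ n := by
    have hn0 : (n : ℝ) ≠ 0 := by positivity
    have h4 : (‖a ^ n‖₊ : ENNReal) ≤ ENNReal.ofReal (2 * R)⁻¹ ^ n := by
      have := ENNReal.rpow_le_rpow hn.le (Nat.cast_nonneg n)
      rwa [← ENNReal.rpow_mul, one_div_mul_cancel hn0, ENNReal.rpow_one,
        ENNReal.rpow_natCast] at this
    rw [← ENNReal.ofReal_pow (by positivity), ENNReal.ofReal, ENNReal.coe_le_coe] at h4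
    have h5 := NNReal.coe_le_coe.2 h4
    rwa [coe_nnnorm, Real.coe_toNNReal _ (by positivity)] at h5
  calc R ^ n * ‖a ^ n‖ ≤ R ^ n * ((2 * R)⁻¹) ^ n := by gcongr
    _ = (1 / 2) ^ n := by rw [← mul_pow]; congr 1; field_simp

/-- Quasinilpotency makes the series `G z` for `ln (1 + z a)` converge for every `z`. Since `G' z *
(1 + z a) = a`, the product `exp (-G z) * (1 + z a)` is constant; compare `z = 0` and `z = 1`.
Characters kill `a`, hence also its logarithm. -/
theorem exists_log_one_add {a : B} (ha : spectralRadius ℂ a = 0) :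
    ∃ b : B, HasSum (fun n : ℕ => ((-1 : ℂ) ^ n / ((n : ℂ) + 1)) • a ^ (n + 1)) b ∧
      spectralRadius ℂ b = 0 ∧ NormedSpace.exp b = 1 + a := by
  set g : ℕ → ℂ → B := fun n z => (((-1 : ℂ) ^ n / ((n : ℂ) + 1)) * z ^ (n + 1)) • a ^ (n + 1)
    with hg
  set g' : ℕ → ℂ → B := fun n z => (-z) ^ n • a ^ (n + 1) with hg'
  have hgd : ∀ n z, HasDerivAt (g n) (g' n z) z := by
    intro n z
    have hn : (n : ℂ) + 1 ≠ 0 := by exact_mod_cast n.succ_ne_zero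
    have h1 := ((hasDerivAt_pow (n + 1) z).const_mul ((-1 : ℂ) ^ n / ((n : ℂ) + 1))).smul_const
      (a ^ (n + 1))
    refine h1.congr_deriv (congrArg (· • a ^ (n + 1)) ?_)
    rw [neg_pow z, Nat.add_sub_cancel]
    push_cast
    field_simp
  have hsum : ∀ z : ℂ, Summable fun n => ‖(-z) ^ n • a ^ n‖ := by
    intro z
    refine .of_nonneg_of_le (fun _ => norm_nonneg _) (fun n => ?_)
      (summable_norm_pow_mul_of_spectralRadius_eq_zero ha (‖z‖ + 1) (by positivity))
    rw [norm_smul, norm_pow, norm_neg]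
    gcongr
    linarith
  have hG : ∀ z, HasDerivAt (fun z => ∑' n, g n z) (∑' n, g' n z) z := by
    intro z
    have hu := ((summable_norm_pow_mul_of_spectralRadius_eq_zero ha (‖z‖ + 1)
      (by positivity)).mul_right ‖a‖)
    refine hasDerivAt_tsum_of_isPreconnected hu (t := Metric.ball 0 (‖z‖ + 1)) (y₀ := 0)
      Metric.isOpen_ball (convex_ball _ _).isPreconnected (fun n y _ => hgd n y)
      (fun n y hy => ?_) (Metric.mem_ball_self (by positivity)) ?_ (by simp)
    · rw [hg']
      simp only
      rw [norm_smul, norm_pow, norm_neg, pow_succ, mul_assoc]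
      have := (mem_ball_zero_iff.1 hy).le
      gcongr
      exact norm_mul_le _ _
    · simp [hg, summable_zero]
  have hG' : ∀ z : ℂ, (∑' n, g' n z) * (1 + z • a) = a := by
    intro z
    have h1 : (∑' n, (-(z • a)) ^ n) * (1 - -(z • a)) = 1 := by
      refine Summable.tsum_pow_mul_one_sub ?_
      refine (hsum z).of_norm.congr fun n => ?_
      rw [← neg_smul, _root_.smul_pow]
    have h2 : ∑' n, g' n z = a * ∑' n, (-(z • a)) ^ n := by
      rw [← Summable.tsum_mul_left]
      · refine tsum_congr fun n => ?_
        simp only [hg']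
        rw [← neg_smul, _root_.smul_pow, pow_succ', mul_smul_comm]
      · refine (hsum z).of_norm.congr fun n => ?_
        rw [← neg_smul, _root_.smul_pow]
    rw [sub_neg_eq_add] at h1
    rw [h2, mul_assoc, h1, mul_one]
  set G : ℂ → B := fun z => ∑' n, g n z with hGdef
  have hconst : ∀ z, HasDerivAt (fun z => NormedSpace.exp (-G z) * (1 + z • a)) 0 z := by
    intro z
    have h1 : HasDerivAt (fun z => NormedSpace.exp (-G z))
        (NormedSpace.exp (-G z) * -∑' n, g' n z) z := by
      have := (hasFDerivAt_exp (𝕂 := ℂ) (x := -G z)).comp_hasDerivAt z (hG z).neg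
      exact this.congr_deriv (by simp)
    have h2 : HasDerivAt (fun z : ℂ => 1 + z • a) a z := by
      simpa using ((hasDerivAt_id z).smul_const a).const_add 1
    refine (h1.mul h2).congr_deriv ?_
    rw [mul_assoc, neg_mul, hG' z]
    ring
  have h01 := is_const_of_deriv_eq_zero (fun z => (hconst z).differentiableAt)
    (fun z => (hconst z).deriv) 1 0
  have hG0 : G 0 = 0 := by simp [hGdef, hg]
  let : NormedAlgebra ℚ B := NormedAlgebra.restrictScalars ℚ ℂ B
  have hexp : NormedSpace.exp (G 1) = 1 + a := by
    simp only [hG0, neg_zero, NormedSpace.exp_zero, zero_smul, add_zero, one_smul, mul_one] at h01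
    have h2 : NormedSpace.exp (G 1) * NormedSpace.exp (-G 1) = 1 := by
      rw [← NormedSpace.exp_add_of_commute (Commute.all _ _), add_neg_cancel, NormedSpace.exp_zero]
    calc NormedSpace.exp (G 1) = NormedSpace.exp (G 1) * (NormedSpace.exp (-G 1) * (1 + a)) := by
          rw [h01, mul_one]
      _ = 1 + a := by rw [← mul_assoc, h2, one_mul]
  have hs : HasSum (fun n : ℕ => ((-1 : ℂ) ^ n / ((n : ℂ) + 1)) • a ^ (n + 1)) (G 1) := by
    have h1 : Summable fun n => g n 1 := by
      have h2 : Summable fun n : ℕ => ‖a ^ (n + 1)‖ := by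
        have := (summable_nat_add_iff 1).2
          (summable_norm_pow_mul_of_spectralRadius_eq_zero ha 1 one_pos)
        simpa using this
      refine .of_norm_bounded h2 fun n => ?_
      simp only [hg, one_pow, mul_one, norm_smul, norm_div, norm_neg, norm_one, norm_pow]
      refine mul_le_of_le_one_left (norm_nonneg _) (div_le_one_of_le₀ ?_ (norm_nonneg _))
      rw [← Nat.cast_add_one, Complex.norm_natCast]
      push_cast
      linarith [n.cast_nonneg (α := ℝ)]
    simpa [hg, hGdef] using h1.hasSum
  refine ⟨G 1, hs, ?_, hexp⟩
  rw [spectralRadius_eq_zero_iff]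
  intro k hk
  obtain ⟨χ, rfl⟩ := WeakDual.CharacterSpace.mem_spectrum_iff_exists.1 hk
  have hχa : χ a = 0 := spectralRadius_eq_zero_iff.1 ha _
    (WeakDual.CharacterSpace.mem_spectrum_iff_exists.2 ⟨χ, rfl⟩)
  have h1 := hs.map χ (map_continuous χ)
  refine h1.unique ?_
  convert hasSum_zero (α := ℂ) (β := ℕ) using 1
  funext n
  simp [hχa]

end Logarithm

/-- A character with value `k ≠ 0` at `a` would send the dense orbit to the numbers `(1 + k) ^ n *
k`, dense in `ℂ`. -/
theorem IsChaoticGenerator.spectralRadius_eq_zero {B : Type*} [NormedCommRing B]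
    [NormedAlgebra ℂ B] [CompleteSpace B] {a : B} (ha : IsChaoticGenerator a) :
    spectralRadius ℂ a = 0 := by
  rw [spectralRadius_eq_zero_iff]
  intro k hk
  obtain ⟨χ, hχ⟩ := WeakDual.CharacterSpace.mem_spectrum_iff_exists.1 hk
  by_contra hk0
  refine not_forall_exists_one_add_pow_mul_near k k fun w ε hε => ?_
  have hmem : (w / k) • a ∈ (Ideal.span {a}).closure := by
    rw [Algebra.smul_def]
    exact Ideal.mul_mem_left _ _ (mem_closure_span_self _)
  obtain ⟨δ, hδ, hδε⟩ := Metric.continuousAt_iff.1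
    ((map_continuous χ).continuousAt (x := (w / k) • a)) ε hε
  obtain ⟨n, -, hn⟩ := ha.one_add_pow _ hmem δ hδ
  refine ⟨n, ?_⟩
  have := hδε (x := (1 + a) ^ n * a) (by rwa [dist_eq_norm])
  rw [dist_eq_norm, map_smul, map_mul, map_pow, map_add, map_one, hχ, smul_eq_mul,
    div_mul_cancel₀ _ hk0] at this
  exact this

/-! ### Multiplication on the closed ideal generated by `a`. -/

section IdealAction

variable {B : Type*} [NormedCommRing B] [NormedAlgebra ℂ B]

/-- An ideal of a commutative algebra, as a non-unital subalgebra. -/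
def idealSubalgebra (J : Ideal B) : NonUnitalSubalgebra ℂ B where
  carrier := J
  add_mem' := J.add_mem
  zero_mem' := J.zero_mem
  mul_mem' := fun {x _} _ hy => J.mul_mem_left x hy
  smul_mem' := fun c x hx => by
    rw [Algebra.smul_def]
    exact J.mul_mem_left _ hx

instance (J : Ideal B) : NormedSpace ℂ (idealSubalgebra J) where
  norm_smul_le c x := norm_smul_le c (x : B)

/-- The action of an algebra on one of its ideals by multiplication. -/
def mulOnIdeal (J : Ideal B) : B →ₐ[ℂ] (idealSubalgebra J →L[ℂ] idealSubalgebra J) where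
  toFun b := LinearMap.mkContinuous
    { toFun := fun x => ⟨b * x, J.mul_mem_left b x.2⟩
      map_add' := fun _ _ => Subtype.ext (mul_add _ _ _)
      map_smul' := fun _ _ => Subtype.ext (mul_smul_comm _ _ _) } ‖b‖
    fun x => norm_mul_le b x
  map_one' := by ext x; exact one_mul (x : B)
  map_mul' b c := by ext x; exact mul_assoc b c x
  map_zero' := by ext x; exact zero_mul (x : B)
  map_add' b c := by ext x; exact add_mul b c (x : B)
  commutes' c := by ext x; exact (Algebra.smul_def c (x : B)).symm

theorem coe_mulOnIdeal_apply (J : Ideal B) (b : B) (x : idealSubalgebra J) :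
    (mulOnIdeal J b x : B) = b * x := rfl

theorem continuous_mulOnIdeal (J : Ideal B) : Continuous (mulOnIdeal J) :=
  AddMonoidHomClass.continuous_of_bound (mulOnIdeal J) 1 fun b => by
    rw [one_mul]
    exact ContinuousLinearMap.opNorm_le_bound _ (norm_nonneg b) fun x => norm_mul_le b x

theorem directSumSelf_pow {X : Type*} [NormedAddCommGroup X] [NormedSpace ℂ X] (T : X →L[ℂ] X)
    (n : ℕ) (x y : X) : (directSumSelf T ^ n) (x, y) = ((T ^ n) x, (T ^ n) y) := by
  induction n with
  | zero => rfl
  | succ n ih => rw [pow_succ', pow_succ', mul_apply_eq_comp, ih]; rfl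

theorem inr_pow_succ_eq {J : Ideal B} (a : idealSubalgebra J) (n : ℕ) :
    (a : Unitization ℂ (idealSubalgebra J)) ^ (n + 1) =
      ((mulOnIdeal J ((a : B) ^ n) a : idealSubalgebra J) :
        Unitization ℂ (idealSubalgebra J)) := by
  induction n with
  | zero => simp
  | succ n ih =>
    rw [pow_succ, ih, ← Unitization.inr_mul]
    congr 1
    apply Subtype.ext
    simp only [MulMemClass.coe_mul, coe_mulOnIdeal_apply]
    ring

theorem one_add_inr_pow_mul_eq {J : Ideal B} (a : idealSubalgebra J) (n : ℕ) :
    (1 + (a : Unitization ℂ (idealSubalgebra J))) ^ n * a =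
      ((mulOnIdeal J ((1 + (a : B)) ^ n) a : idealSubalgebra J) :
        Unitization ℂ (idealSubalgebra J)) := by
  induction n with
  | zero => simp
  | succ n ih =>
    rw [pow_succ', mul_assoc, ih, add_mul, one_mul, ← Unitization.inr_mul, ← Unitization.inr_add]
    congr 1
    apply Subtype.ext
    simp only [NonUnitalSubalgebra.coe_add, MulMemClass.coe_mul, coe_mulOnIdeal_apply]
    ring

/-- The generator, as an element of the closed ideal that it generates. -/
def generator (a : B) : idealSubalgebra (Ideal.span {a}).closure :=
  ⟨a, mem_closure_span_self a⟩

namespace IsChaoticGenerator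

variable {a : B}

theorem dense_orbit (ha : IsChaoticGenerator a) :
    Dense {x | ∃ n : ℕ, 1 ≤ n ∧
      x = mulOnIdeal (Ideal.span {a}).closure ((1 + a) ^ n) (generator a)} := by
  intro b
  refine Metric.mem_closure_iff.2 fun ε hε => ?_
  obtain ⟨n, hn, h⟩ := ha.one_add_pow b b.2 ε hε
  refine ⟨_, ⟨n, hn, rfl⟩, ?_⟩
  rw [dist_comm, dist_eq_norm]
  exact h

theorem isChaoticElement (ha : IsChaoticGenerator a) : IsChaoticElement (generator a) := by
  constructor
  · intro b
    refine Metric.mem_closure_iff.2 fun ε hε => ?_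
    obtain ⟨c, n, hn, h⟩ := ha.pow b b.2 ε hε
    obtain ⟨n, rfl⟩ := Nat.exists_eq_succ_of_ne_zero (Nat.one_le_iff_ne_zero.1 hn)
    refine ⟨c • mulOnIdeal (Ideal.span {a}).closure (a ^ n) (generator a), ⟨c, n + 1, hn, ?_⟩, ?_⟩
    · rw [inr_pow_succ_eq, Unitization.inr_smul]
      rfl
    · rw [dist_comm, dist_eq_norm]
      rw [pow_succ] at h
      exact h
  · refine ha.dense_orbit.mono ?_
    rintro _ ⟨n, hn, rfl⟩
    exact ⟨n, hn, (one_add_inr_pow_mul_eq (generator a) n).symm⟩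

/-- In finite dimension the transpose of multiplication by `1 + a` has an eigenvector `f`, and `f`
would map the dense orbit onto a geometric sequence dense in `ℂ`. -/
theorem not_finiteDimensional (ha : IsChaoticGenerator a) :
    ¬ FiniteDimensional ℂ (idealSubalgebra (Ideal.span {a}).closure) := by
  intro hfin
  set J := (Ideal.span {a}).closure
  have : Nontrivial (idealSubalgebra J) :=
    ⟨generator a, 0, fun h => ha.ne_zero (congrArg Subtype.val h)⟩
  obtain ⟨l, hl⟩ := Module.End.exists_eigenvalue
    (LinearMap.dualMap (mulOnIdeal J (1 + a)).toLinearMap)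
  obtain ⟨f, hf⟩ := hl.exists_hasEigenvector
  have hfx : ∀ x, f (mulOnIdeal J (1 + a) x) = l * f x := fun x =>
    LinearMap.congr_fun hf.apply_eq_smul x
  have hfn : ∀ (n : ℕ) x, f (mulOnIdeal J ((1 + a) ^ n) x) = l ^ n * f x := by
    intro n x
    induction n with
    | zero => simp
    | succ n ih => rw [pow_succ', map_mul, mul_apply_eq_comp, hfx, ih]; ring
  have hfc : Continuous f := f.continuous_of_finiteDimensional
  have hfs : Function.Surjective f := LinearMap.surjective hf.2
  refine not_forall_exists_one_add_pow_mul_near (l - 1) (f (generator a)) fun w ε hε => ?_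
  obtain ⟨b, rfl⟩ := hfs w
  obtain ⟨_, hy, n, -, rfl⟩ := mem_closure_iff.1 (ha.dense_orbit b) _
    ((Metric.isOpen_ball (x := f b) (ε := ε)).preimage hfc) (Metric.mem_ball_self hε)
  refine ⟨n, ?_⟩
  rw [Set.mem_preimage, mem_ball_iff_norm, hfn] at hy
  rwa [add_sub_cancel]

/-- The action on `A × A` of a family of multiplications has no dense orbit. -/
theorem not_dense_range_prod (ha : IsChaoticGenerator a) {ι : Type*} (b : ι → B)
    (x y : idealSubalgebra (Ideal.span {a}).closure) :
    ¬ Dense (Set.range fun i => (mulOnIdeal (Ideal.span {a}).closure (b i) x,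
      mulOnIdeal (Ideal.span {a}).closure (b i) y)) := by
  intro hd
  -- Each orbit point `(b x, b y)` satisfies `(b x) y = (b y) x`, a closed condition, so density
  -- extends it to all pairs.
  have h1 : ∀ p : idealSubalgebra (Ideal.span {a}).closure ×
      idealSubalgebra (Ideal.span {a}).closure, (p.1 : B) * y = p.2 * x := by
    intro p
    refine hd.induction (P := fun p => (p.1 : B) * y = p.2 * x) ?_
      (isClosed_eq (by fun_prop) (by fun_prop)) p
    rintro _ ⟨i, rfl⟩
    simp only [coe_mulOnIdeal_apply]
    rw [mul_assoc, mul_assoc, mul_comm (x : B)]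
  -- The pair `(0, a)` gives `a x = 0`, hence `a` annihilates the orbit of `x` and so the whole
  -- ideal. Then `a * a = 0`, and the orbit of `a` is constant.
  have hax : a * x = 0 := (h1 (0, generator a)).symm.trans (zero_mul _)
  have h2 : ∀ z : idealSubalgebra (Ideal.span {a}).closure, a * (z : B) = 0 := by
    intro z
    refine hd.induction (P := fun p => a * (p.1 : B) = 0) ?_
      (isClosed_eq (by fun_prop) (by fun_prop)) (z, 0)
    rintro _ ⟨i, rfl⟩
    simp only [coe_mulOnIdeal_apply]
    rw [mul_left_comm, hax, mul_zero]
  have haa : a * a = 0 := h2 (generator a)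
  have hpow : ∀ n : ℕ, (1 + a) ^ n * a = a := by
    intro n
    induction n with
    | zero => simp
    | succ n ih => rw [pow_succ', mul_assoc, ih, add_mul, haa, one_mul, add_zero]
  obtain ⟨n, -, hn⟩ := ha.one_add_pow 0 (Ideal.zero_mem _) ‖a‖ (norm_pos_iff.2 ha.ne_zero)
  rw [hpow, sub_zero] at hn
  exact lt_irrefl _ hn

end IsChaoticGenerator

theorem spectralRadius_mulOnIdeal_eq_zero (J : Ideal B) {b : B} (hb : spectralRadius ℂ b = 0) :
    spectralRadius ℂ (mulOnIdeal J b) = 0 :=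
  spectralRadius_eq_zero_iff.2 fun k hk =>
    spectralRadius_eq_zero_iff.1 hb k (AlgHom.spectrum_apply_subset (mulOnIdeal J) b hk)

theorem map_exp_operator [CompleteSpace B] {X : Type*} [NormedAddCommGroup X] [NormedSpace ℂ X]
    (f : B →ₐ[ℂ] (X →L[ℂ] X)) (hf : Continuous f) (b : B) :
    f (NormedSpace.exp b) = NormedSpace.exp (f b) := by
  let : NormedAlgebra ℚ B := NormedAlgebra.restrictScalars ℚ ℂ B
  let : Algebra ℚ (X →L[ℂ] X) := Algebra.compHom _ (algebraMap ℚ ℂ)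
  exact NormedSpace.map_exp f hf b

theorem expSemigroup_mulOnIdeal [CompleteSpace B] (J : Ideal B) (b : B) (t : ℝ≥0) :
    expSemigroup (mulOnIdeal J b) t =
      mulOnIdeal J (NormedSpace.exp (((t : ℝ) : ℂ) • b)) := by
  rw [expSemigroup, ← map_smul]
  exact (map_exp_operator (mulOnIdeal J) (continuous_mulOnIdeal J) _).symm

theorem continuous_expSemigroup_mulOnIdeal [CompleteSpace B] (J : Ideal B) (b : B) :
    Continuous (expSemigroup (mulOnIdeal J b)) := by
  let : NormedAlgebra ℚ B := NormedAlgebra.restrictScalars ℚ ℂ B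
  rw [funext (expSemigroup_mulOnIdeal J b)]
  exact (continuous_mulOnIdeal J).comp (NormedSpace.exp_continuous.comp (by fun_prop))

theorem isStronglyContinuousSemigroup_expSemigroup_mulOnIdeal [CompleteSpace B] (J : Ideal B)
    (b : B) : IsStronglyContinuousSemigroup (expSemigroup (mulOnIdeal J b)) where
  map_zero := by
    rw [expSemigroup_mulOnIdeal]
    simp
    rfl
  map_add s t := by
    let : NormedAlgebra ℚ B := NormedAlgebra.restrictScalars ℚ ℂ B
    simp only [expSemigroup_mulOnIdeal]
    rw [NNReal.coe_add, Complex.ofReal_add, add_smul,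
      NormedSpace.exp_add_of_commute (Commute.all _ _), map_mul]
    rfl
  continuous_orbit x := (continuous_expSemigroup_mulOnIdeal J b).clm_apply continuous_const

theorem IsStronglyContinuousSemigroup.directSumSelf {X : Type*} [NormedAddCommGroup X]
    [NormedSpace ℂ X] {T : ℝ≥0 → X →L[ℂ] X} (hT : IsStronglyContinuousSemigroup T) :
    IsStronglyContinuousSemigroup fun t => directSumSelf (T t) where
  map_zero := by rw [hT.map_zero]; rfl
  map_add s t := by rw [hT.map_add]; rfl
  continuous_orbit x := (hT.continuous_orbit x.1).prodMk (hT.continuous_orbit x.2)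

end IdealAction

end

/-! ### Assembly. -/

theorem mainTheorem5 :
    ∃ (A : Type) (_ : NonUnitalNormedCommRing A) (_ : NormedSpace ℂ A)
      (_ : IsScalarTower ℂ A A) (_ : SMulCommClass ℂ A A) (_ : CompleteSpace A)
      (a : A) (S : A →L[ℂ] A),
      ¬ FiniteDimensional ℂ A ∧
      IsChaoticElement a ∧
      IsQuasinilpotentOperator (mulOperator a) ∧
      IsHypercyclicOperator (ContinuousLinearMap.id ℂ A + mulOperator a) ∧
      ¬ IsHypercyclicOperator (directSumSelf (ContinuousLinearMap.id ℂ A + mulOperator a)) ∧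
      HasSum (fun n : ℕ => ((-1 : ℂ) ^ n / ((n : ℂ) + 1)) • mulOperator a ^ (n + 1)) S ∧
      IsQuasinilpotentOperator S ∧
      (∀ n : ℕ, expSemigroup S (n : ℝ≥0) = (ContinuousLinearMap.id ℂ A + mulOperator a) ^ n) ∧
      IsStronglyContinuousSemigroup (expSemigroup S) ∧
      Continuous (expSemigroup S) ∧
      IsHypercyclicSemigroup (expSemigroup S) ∧
      IsStronglyContinuousSemigroup (fun t : ℝ≥0 => directSumSelf (expSemigroup S t)) ∧
      ¬ IsHypercyclicSemigroup (fun t : ℝ≥0 => directSumSelf (expSemigroup S t)) := by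
  obtain ⟨B, _, _, _, a, ha⟩ := exists_isChaoticGenerator
  set J : Ideal B := (Ideal.span {a}).closure with hJ
  obtain ⟨b, hb, hb0, hexp⟩ := exists_log_one_add ha.spectralRadius_eq_zero
  have hM : mulOperator (generator a) = mulOnIdeal J a := rfl
  have hIM : ContinuousLinearMap.id ℂ (idealSubalgebra J) + mulOperator (generator a) =
      mulOnIdeal J (1 + a) := by
    rw [map_add, map_one]; rfl
  have hn : ∀ n : ℕ, expSemigroup (mulOnIdeal J b) (n : ℝ≥0) = mulOnIdeal J (1 + a) ^ n := by
    intro n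
    let : NormedAlgebra ℚ B := NormedAlgebra.restrictScalars ℚ ℂ B
    rw [expSemigroup_mulOnIdeal, ← map_pow, ← hexp, ← NormedSpace.exp_nsmul]
    congr 2
    simp [Nat.cast_smul_eq_nsmul]
  have hclosed : IsClosed (idealSubalgebra J : Set B) := by
    change IsClosed (J : Set B)
    rw [hJ, Ideal.coe_closure]
    exact isClosed_closure
  have hsg := isStronglyContinuousSemigroup_expSemigroup_mulOnIdeal J b
  refine ⟨idealSubalgebra J, inferInstance, inferInstance, inferInstance, inferInstance,
    hclosed.completeSpace_coe, generator a, mulOnIdeal J b, ha.not_finiteDimensional,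
    ha.isChaoticElement, ?_, ?_, ?_, ?_, spectralRadius_mulOnIdeal_eq_zero J hb0, ?_, hsg,
    continuous_expSemigroup_mulOnIdeal J b, ?_, hsg.directSumSelf, ?_⟩
  · exact spectralRadius_mulOnIdeal_eq_zero J ha.spectralRadius_eq_zero
  · refine ⟨generator a, ha.dense_orbit.mono ?_⟩
    rintro _ ⟨n, -, rfl⟩
    exact ⟨n, by simp only [hIM, map_pow]; rfl⟩
  · rintro ⟨⟨x, y⟩, h⟩
    refine ha.not_dense_range_prod (fun n : ℕ => (1 + a) ^ n) x y ?_
    simpa only [directSumSelf_pow, hIM, map_pow] using h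
  · have := hb.map (mulOnIdeal J) (continuous_mulOnIdeal J)
    simpa only [Function.comp_def, map_smul, map_pow, hM] using this
  · intro n
    rw [hn, hIM]
  -- Integer times already give a dense orbit.
  · refine ⟨generator a, ha.dense_orbit.mono ?_⟩
    rintro _ ⟨n, -, rfl⟩
    exact ⟨n, by simp only [hn, map_pow]; rfl⟩
  · rintro ⟨⟨x, y⟩, h⟩
    refine ha.not_dense_range_prod (fun t : ℝ≥0 => NormedSpace.exp (((t : ℝ) : ℂ) • b)) x y ?_
    simp only [expSemigroup_mulOnIdeal] at h
    exact h
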